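/- **Theorem 1 ($H_{\min}$ for stabilizer codes).** Let $S$ be the stabilizer group of an $[[n,k,d]]$ stabilizer code: an abelian subgroup of the $n$-qubit Pauli group $P_n=\{i^c\,\sigma_1\otimes\cdots\otimes\sigma_n : c\in\mathbb Z,\ \sigma_j\in\{I,X,Y,Z\}\}$ with $-I\notin S$ and $|S|=2^{n-k}$, such that every element of the normalizer $N(S)$ of $S$ in $P_n$ acting nontrivially on fewer than $d$ qubits is a stabilizer up to a global phase. Let $V:\mathbb C^{2^k}\to\mathbb C^{2^n}$ be an isometry onto the code space $\{\psi : s\psi=\psi \text{ for all } s\in S\}$. Let $|\Phi_{RE}\rangle=2^{-k/2}\sum_i|i\rangle_R|i\rangle_E$ be the maximally entangled state of two $k$-qubit systems. Encode its second half by $V$ and erase (trace out) the qubits in the complement $M^c$ of a set $M$ of qubits, which gives $$\rho_{RM}=\operatorname{Tr}_{M^c}\big[(I_R\otimes V)|\Phi_{RE}\rangle\langle\Phi_{RE}|(I_R\otimes V)^\dagger\big].$$ Let $N_{M^c}(S)$ and $S_{M^c}$ be the sets of elements of $N(S)$ and of $S$ that act as the identity (up to a phase) on every qubit in $M$, and let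 $G_{M^c}=N_{M^c}(S)/S_{M^c}$, with Pauli operators identified when they differ only by a global phase; this is the group of logical Paulis that can be cleaned onto $M^c$. Then the maximum fidelity with $\Phi_{RE}$ after recovery is attained and equals $$\max_{\mathcal R}F\big(|\Phi_{RE}\rangle\langle\Phi_{RE}|,(I_R\otimes\mathcal R)(\rho_{RM})\big)=\frac1{|G_{M^c}|},$$ where $\mathcal R$ ranges over all quantum channels (completely positive trace-preserving maps) from the qubits in $M$ to $k$ qubits and $F(\rho,\sigma)=\big(\operatorname{Tr}\sqrt{\sqrt\rho\,\sigma\sqrt\rho}\big)^2$. Moreover, the conditional min-entropy of the state $\rho_{RM}$, defined by $H_{\min}(R|E)=-\log_2 q_{\rm corr}$ with $q_{\rm corr}=2^k\sup_{\mathcal R}F\big((I_R\otimes\mathcal R)(\rho_{RM}),|\Phi_{RE}\rangle\langle\Phi_{RE}|\big)$, is $$H_{\min}(R|E)=-\log_2\frac{2^k}{|G_{M^c}|}=\log_2|G_{M^c}|-k.$$ -/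

import Mathlib

open scoped Matrix Kronecker ComplexOrder MatrixOrder

/-! ### Bipartite quantum states, channels, fidelity, conditional min-entropy

A quantum system with orthonormal basis labelled by a finite type `a` has state space `a → ℂ`;
operators on it are matrices, and a joint system `R E` is labelled by `r × e`. -/

/-- The rank-one operator `|ψ⟩⟨ψ|`. -/
noncomputable def ketbra {a : Type} (ψ : a → ℂ) : Matrix a a ℂ :=
  Matrix.vecMulVec ψ (star ψ)

/-- The map `id_R ⊗ Φ` on operators, for a linear map `Φ` from operators on `e` to operators
on `f`: the map `Φ` is applied to each `e`-block. -/
def idTensor {e f : Type} (r : Type) (Φ : Matrix e e ℂ →ₗ[ℂ] Matrix f f ℂ)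
    (ρ : Matrix (r × e) (r × e) ℂ) : Matrix (r × f) (r × f) ℂ :=
  Matrix.of fun p q => Φ (Matrix.of fun x y => ρ (p.1, x) (q.1, y)) p.2 q.2

/-- Quantum channels: completely positive and trace-preserving linear maps. -/
structure IsChannel {e f : Type} [Fintype e] [Fintype f]
    (Φ : Matrix e e ℂ →ₗ[ℂ] Matrix f f ℂ) : Prop where
  completely_positive : ∀ (r : Type) [Finite r] (ρ : Matrix (r × e) (r × e) ℂ),
    ρ.PosSemidef → (idTensor r Φ ρ).PosSemidef
  trace_preserving : ∀ X : Matrix e e ℂ, (Φ X).trace = X.trace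

/-- The fidelity `F(ρ, σ) = (Tr √(√ρ σ √ρ))²` of two density operators. -/
noncomputable def fidelity {a : Type} [Fintype a] [DecidableEq a] (ρ σ : Matrix a a ℂ) : ℝ :=
  (Matrix.trace (CFC.sqrt (CFC.sqrt ρ * σ * CFC.sqrt ρ))).re ^ 2

/-- The maximally entangled vector `|Φ⟩ = d^{-1/2} ∑ i, |i⟩|i⟩`, where `d = |r|`. -/
noncomputable def maxEntangled (r : Type) [Fintype r] [DecidableEq r] : r × r → ℂ :=
  fun p => if p.1 = p.2 then ((1 / Real.sqrt (Fintype.card r) : ℝ) : ℂ) else 0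

/-- `q_corr(R|E)_ρ = d_R · sup F((id_R ⊗ 𝓡)(ρ), |Φ⟩⟨Φ|)`, over all channels `𝓡` from the system
`E` to a copy of `R`. -/
noncomputable def qCorr {r e : Type} [Fintype r] [DecidableEq r] [Fintype e]
    (ρ : Matrix (r × e) (r × e) ℂ) : ℝ :=
  (Fintype.card r : ℝ) *
    sSup {F : ℝ | ∃ 𝓡 : Matrix e e ℂ →ₗ[ℂ] Matrix r r ℂ, IsChannel 𝓡 ∧
      F = fidelity (idTensor r 𝓡 ρ) (ketbra (maxEntangled r))}

/-- The conditional min-entropy `H_min(R|E)_ρ = - log₂ q_corr(R|E)_ρ`. -/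
noncomputable def condMinEntropy {r e : Type} [Fintype r] [DecidableEq r] [Fintype e]
    (ρ : Matrix (r × e) (r × e) ℂ) : ℝ :=
  - Real.logb 2 (qCorr ρ)

/-! ### Qubits and Pauli operators -/

/-- Labels of the computational basis of the qubits indexed by `J`. -/
abbrev Bits (J : Type) : Type := J → Fin 2

/-- The single-qubit Pauli matrices `I, X, Y, Z`, in this order. -/
def pauliMatrix : Fin 4 → Matrix (Fin 2) (Fin 2) ℂ :=
  ![1, !![0, 1; 1, 0], !![0, -Complex.I; Complex.I, 0], !![1, 0; 0, -1]]

/-- The tensor product `σ_{P 0} ⊗ ⋯ ⊗ σ_{P (n-1)}`, as an operator on `n` qubits. -/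
def pauliString {n : ℕ} (P : Fin n → Fin 4) : Matrix (Bits (Fin n)) (Bits (Fin n)) ℂ :=
  Matrix.of fun a b => ∏ j, pauliMatrix (P j) (a j) (b j)

/-- The product of two Pauli matrices is a Pauli matrix up to a power of `i`. -/
theorem pauliMatrix_mul (s t : Fin 4) : ∃ (c : ℕ) (u : Fin 4), (s = 0 → t = 0 → u = 0) ∧
    pauliMatrix s * pauliMatrix t = Complex.I ^ c • pauliMatrix u := by
  have key : pauliMatrix s * pauliMatrix t =
      Complex.I ^ ((![![0, 0, 0, 0], ![0, 0, 1, 3], ![0, 3, 0, 1], ![0, 1, 3, 0]] :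
        Fin 4 → Fin 4 → ℕ) s t) • pauliMatrix ((![![0, 1, 2, 3], ![1, 0, 3, 2], ![2, 3, 0, 1],
        ![3, 2, 1, 0]] : Fin 4 → Fin 4 → Fin 4) s t) := by
    have h3 : Complex.I ^ 3 = -Complex.I := Complex.I_pow_three
    fin_cases s <;> fin_cases t <;>
      (ext i j; fin_cases i <;> fin_cases j <;>
        simp [pauliMatrix, Matrix.mul_apply, Fin.sum_univ_two, h3, Matrix.one_apply])
  refine ⟨_, _, ?_, key⟩
  rintro rfl rfl
  rfl

theorem pauliMatrix_mul_self (s : Fin 4) : pauliMatrix s * pauliMatrix s = 1 := by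
  fin_cases s <;> (ext i j; fin_cases i <;> fin_cases j <;>
    simp [pauliMatrix, Matrix.mul_apply, Fin.sum_univ_two, Matrix.one_apply])

theorem pauliString_mul_apply {n : ℕ} (P Q : Fin n → Fin 4) (a b : Bits (Fin n)) :
    (pauliString P * pauliString Q) a b =
      ∏ j, (pauliMatrix (P j) * pauliMatrix (Q j)) (a j) (b j) := by
  simp only [pauliString, Matrix.mul_apply, Matrix.of_apply, ← Finset.prod_mul_distrib]
  rw [Finset.prod_univ_sum, Fintype.piFinset_univ]

theorem pauliString_zero {n : ℕ} : pauliString (0 : Fin n → Fin 4) = 1 := by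
  ext a b
  simp only [pauliString, Matrix.of_apply, Pi.zero_apply, pauliMatrix, Matrix.cons_val_zero,
    Matrix.one_apply]
  rw [Finset.prod_ite_zero]
  simp [funext_iff]

theorem pauliString_mul_self {n : ℕ} (P : Fin n → Fin 4) :
    pauliString P * pauliString P = 1 := by
  ext a b
  rw [pauliString_mul_apply, ← pauliString_zero]
  simp only [pauliMatrix_mul_self, pauliString, Matrix.of_apply]
  rfl

theorem pauliString_mul {n : ℕ} (P Q : Fin n → Fin 4) :
    ∃ (c : ℕ) (U : Fin n → Fin 4), (∀ j, P j = 0 → Q j = 0 → U j = 0) ∧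
      pauliString P * pauliString Q = Complex.I ^ c • pauliString U := by
  choose c u h0 h using pauliMatrix_mul
  refine ⟨∑ j, c (P j) (Q j), fun j => u (P j) (Q j), fun j => h0 _ _, ?_⟩
  ext a b
  rw [pauliString_mul_apply]
  simp only [h, Matrix.smul_apply, smul_eq_mul, Finset.prod_mul_distrib, Finset.prod_pow_eq_pow_sum,
    pauliString, Matrix.of_apply]

/-- The unitary group of `n` qubits. -/
abbrev QubitUnitary (n : ℕ) : Type := Matrix.unitaryGroup (Bits (Fin n)) ℂ

/-- The group of the `n`-qubit Pauli operators `i^c σ_{P 0} ⊗ ⋯ ⊗ σ_{P (n-1)}` that are supported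
on `A`, that is, with tensor factor `I` on every qubit outside `A`. -/
def pauliOn {n : ℕ} (A : Finset (Fin n)) : Subgroup (QubitUnitary n) where
  carrier := {U | ∃ (c : ℕ) (P : Fin n → Fin 4), (∀ j, j ∉ A → P j = 0) ∧
    (U : Matrix (Bits (Fin n)) (Bits (Fin n)) ℂ) = Complex.I ^ c • pauliString P}
  one_mem' := ⟨0, 0, fun _ _ => rfl, by simp [pauliString_zero]⟩
  mul_mem' := by
    rintro U W ⟨c, P, hP, hU⟩ ⟨d, Q, hQ, hW⟩
    obtain ⟨e, R, hR, h⟩ := pauliString_mul P Q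
    refine ⟨c + d + e, R, fun j hj => hR j (hP j hj) (hQ j hj), ?_⟩
    rw [Submonoid.coe_mul, hU, hW, smul_mul_smul_comm, h, smul_smul, pow_add, pow_add]
  inv_mem' := by
    rintro U ⟨c, P, hP, hU⟩
    refine ⟨3 * c, P, hP, ?_⟩
    have h1 : (U : Matrix (Bits (Fin n)) (Bits (Fin n)) ℂ) *
        (Complex.I ^ (3 * c) • pauliString P) = 1 := by
      rw [hU, smul_mul_smul_comm, pauliString_mul_self, ← pow_add,
        show c + 3 * c = 4 * c by ring, pow_mul, Complex.I_pow_four, one_pow, one_smul]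
    have h2 : ((U⁻¹ : QubitUnitary n) : Matrix (Bits (Fin n)) (Bits (Fin n)) ℂ) *
        (U : Matrix (Bits (Fin n)) (Bits (Fin n)) ℂ) = 1 := by
      rw [← Submonoid.coe_mul, inv_mul_cancel, Submonoid.coe_one]
    exact left_inv_eq_right_inv h2 h1

/-- The `n`-qubit Pauli group `{i^c σ_{P 0} ⊗ ⋯ ⊗ σ_{P (n-1)}}`. -/
abbrev pauliGroup (n : ℕ) : Subgroup (QubitUnitary n) := pauliOn Finset.univ

/-- The global phases `{I, iI, -I, -iI}`. -/
abbrev phases (n : ℕ) : Subgroup (QubitUnitary n) := pauliOn ∅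

/-! ### Stabilizer codes and cleaned logical operators -/

/-- `N_A(S)`: the elements of the normalizer of `S` in the Pauli group that are supported
on `A`. -/
def normalizerOn {n : ℕ} (S : Subgroup (QubitUnitary n)) (A : Finset (Fin n)) :
    Subgroup (QubitUnitary n) :=
  Subgroup.normalizer (S : Set (QubitUnitary n)) ⊓ pauliOn A

/-- The elements of `S` that are supported on `A` (this is `S_A`), and their multiples by
global phases. -/
def stabilizerOn {n : ℕ} (S : Subgroup (QubitUnitary n)) (A : Finset (Fin n)) :
    Subgroup (QubitUnitary n) :=
  (S ⊓ pauliOn A) ⊔ phases n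

theorem phases_comm {n : ℕ} {z : QubitUnitary n} (hz : z ∈ phases n) (U : QubitUnitary n) :
    U * z * U⁻¹ = z := by
  obtain ⟨c, P, hP, h⟩ := hz
  have hP0 : P = 0 := funext fun j => hP j (by simp)
  rw [hP0, pauliString_zero] at h
  rw [mul_inv_eq_iff_eq_mul]
  apply Subtype.ext
  rw [Submonoid.coe_mul, Submonoid.coe_mul, h]
  simp

instance stabilizerOn_normal {n : ℕ} (S : Subgroup (QubitUnitary n)) (A : Finset (Fin n)) :
    ((stabilizerOn S A).subgroupOf (normalizerOn S A)).Normal := by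
  constructor
  rintro ⟨x, hx⟩ hxT ⟨g, hg⟩
  rw [Subgroup.mem_subgroupOf] at hxT ⊢
  change g * x * g⁻¹ ∈ (S ⊓ pauliOn A) ⊔ phases n
  change x ∈ (S ⊓ pauliOn A) ⊔ phases n at hxT
  have hle : (S ⊓ pauliOn A) ⊔ phases n ≤
      ((S ⊓ pauliOn A) ⊔ phases n).comap (MulAut.conj g).toMonoidHom := by
    refine sup_le (fun y hy => ?_) (fun y hy => ?_)
    · exact Subgroup.mem_sup_left ⟨(hg.1 y).1 hy.1,
        (pauliOn A).mul_mem ((pauliOn A).mul_mem hg.2 hy.2) ((pauliOn A).inv_mem hg.2)⟩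
    · change g * y * g⁻¹ ∈ (S ⊓ pauliOn A) ⊔ phases n
      rw [phases_comm hy]
      exact Subgroup.mem_sup_right hy
  exact hle hxT

/-- The group `G_A` of logical Pauli operators (up to global phase) that can be cleaned onto `A`,
namely `N_A(S) / S_A`. -/
abbrev CleanedLogicals {n : ℕ} (S : Subgroup (QubitUnitary n)) (A : Finset (Fin n)) : Type :=
  normalizerOn S A ⧸ (stabilizerOn S A).subgroupOf (normalizerOn S A)

/-- `S` is the stabilizer group of an `[[n, k, d]]` stabilizer code: an abelian subgroup of the
Pauli group of order `2 ^ (n - k)` not containing `-I`, such that every Pauli operator in its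
normalizer that acts on fewer than `d` qubits is a stabilizer up to global phase. -/
structure IsStabilizerGroup {n : ℕ} (S : Subgroup (QubitUnitary n)) (k d : ℕ) : Prop where
  le_pauliGroup : S ≤ pauliGroup n
  comm : ∀ s ∈ S, ∀ t ∈ S, s * t = t * s
  neg_one_notMem : (-1 : QubitUnitary n) ∉ S
  le_qubits : k ≤ n
  card_eq : Nat.card S = 2 ^ (n - k)
  distance : ∀ B : Finset (Fin n), B.card < d → normalizerOn S B ≤ stabilizerOn S B

/-- The code space: the common `+1` eigenspace of the stabilizer group. -/
def codeSpace {n : ℕ} (S : Subgroup (QubitUnitary n)) : Submodule ℂ (Bits (Fin n) → ℂ) where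
  carrier := {ψ | ∀ s ∈ S, (s : Matrix (Bits (Fin n)) (Bits (Fin n)) ℂ) *ᵥ ψ = ψ}
  add_mem' := by
    intro ψ φ hψ hφ s hs
    rw [Matrix.mulVec_add, hψ s hs, hφ s hs]
  zero_mem' := fun s _ => Matrix.mulVec_zero _
  smul_mem' := by
    intro c ψ hψ s hs
    rw [Matrix.mulVec_smul, hψ s hs]

/-- `V` is an encoding isometry of `k` qubits into the code with stabilizer group `S`: its columns,
the encoded basis states, form an orthonormal basis of the code space. -/
structure IsEncoder {n k : ℕ} (S : Subgroup (QubitUnitary n))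
    (V : Matrix (Bits (Fin n)) (Bits (Fin k)) ℂ) : Prop where
  isometry : Vᴴ * V = 1
  range_eq : LinearMap.range V.mulVecLin = codeSpace S

/-! ### The erasure experiment -/

/-- The label of a basis state of all the qubits, from its parts on `M` and on the complement
of `M`. -/
def joinBits {n : ℕ} (M : Finset (Fin n)) (x : Bits {j // j ∈ M}) (c : Bits {j // j ∉ M}) :
    Bits (Fin n) :=
  fun j => if h : j ∈ M then x ⟨j, h⟩ else c ⟨j, h⟩

/-- The erasure of the qubits outside `M`: the partial trace over them. -/
noncomputable def keepQubits {n : ℕ} {r : Type} (M : Finset (Fin n))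
    (ρ : Matrix (r × Bits (Fin n)) (r × Bits (Fin n)) ℂ) :
    Matrix (r × Bits {j // j ∈ M}) (r × Bits {j // j ∈ M}) ℂ :=
  Matrix.of fun p q => ∑ c : Bits {j // j ∉ M},
    ρ (p.1, joinBits M p.2 c) (q.1, joinBits M q.2 c)

/-- The state `|Φ_RE⟩` of two `k`-qubit systems after the encoding of its second half by `V`:
`2^{-k/2} ∑ i, |i⟩_R ⊗ V|i⟩`. -/
noncomputable def encodedState {n k : ℕ} (V : Matrix (Bits (Fin n)) (Bits (Fin k)) ℂ) :
    Bits (Fin k) × Bits (Fin n) → ℂ :=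
  ((1 : Matrix (Bits (Fin k)) (Bits (Fin k)) ℂ) ⊗ₖ V) *ᵥ maxEntangled (Bits (Fin k))

/-- The joint state of the reference system and the qubits in `M`, after the second half of
`|Φ_RE⟩` has been encoded by `V` and the qubits outside `M` have been erased. -/
noncomputable def erasedState {n k : ℕ} (V : Matrix (Bits (Fin n)) (Bits (Fin k)) ℂ)
    (M : Finset (Fin n)) :
    Matrix (Bits (Fin k) × Bits {j // j ∈ M}) (Bits (Fin k) × Bits {j // j ∈ M}) ℂ :=
  keepQubits M (ketbra (encodedState V))

/-! ### Fidelity with a pure state -/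

section PureFidelity

variable {a : Type} [Fintype a]

/-! Both `ρ = ρ_RM` and its marginal `σ = ρ_M` are flat, that is, multiples of projectors: `ρ² = cρ`
and `σ² = c'σ`. For such a state the optimal recovery fidelity is `c / (c' 2^k)`
(`isGreatest_fidelity_of_flat`). With `P = σ/c'` the support projector of `σ`, the support of `ρ`
lies in that of `1 ⊗ P`, so `ρ ≤ c (1 ⊗ P)`. A channel preserves this inequality, and the overlap of
`1 ⊗ 𝓡(P)` with `Φ` is `tr P / 2^k = 1 / (c' 2^k)`. Equality holds for the channel with Choi matrix
`ρ/c'`, transposed and completed outside `P` to preserve the trace.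

Flatness comes from `V Vᴴ = |S|⁻¹ ∑ s`. A partial trace kills every stabilizer that is nontrivial on
the traced-out qubits. What survives is a multiple of the sum over a subgroup, hence of a projector
(`traceLeft_sum_mul_self`). This applies directly to `ρ_M`. The global state is pure, so `ρ_RM` has
the nonzero spectrum of `ρ_{Mᶜ}`, to which it also applies. The constants are `c = 2^{|M|-n}
|S_{Mᶜ}|` and `c' = 2^{|Mᶜ|-n} |S_M|`.

It remains to count: `|S| |G_A| |S_A| = 4^{|A|} |S_{Aᶜ}|` with `A = Mᶜ` turns `c / (c' 2^k)` into
`1/|G_{Mᶜ}|`. The count sums the commutation signs between `S` and the Paulis on `A` in two orders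
(`card_mul_card_commuting`). By character orthogonality one order counts the Paulis on `A` that
centralize `S`, the other the stabilizers supported on `Aᶜ`. -/

theorem star_dotProduct_self_eq_ofReal (ψ : a → ℂ) :
    star ψ ⬝ᵥ ψ = (((star ψ ⬝ᵥ ψ).re : ℝ) : ℂ) :=
  Complex.eq_re_of_ofReal_le (r := 0) (by simp)

theorem star_dotProduct_self_re_nonneg (ψ : a → ℂ) : 0 ≤ (star ψ ⬝ᵥ ψ).re := by
  have h : 0 ≤ star ψ ⬝ᵥ ψ := by simp
  exact (Complex.le_def.1 h).1

theorem trace_ketbra (ψ : a → ℂ) : (ketbra ψ).trace = star ψ ⬝ᵥ ψ := by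
  rw [ketbra, Matrix.trace_vecMulVec, dotProduct_comm]

theorem ketbra_mul_ketbra (ψ : a → ℂ) : ketbra ψ * ketbra ψ = (star ψ ⬝ᵥ ψ) • ketbra ψ := by
  rw [ketbra, Matrix.vecMulVec_mul_vecMulVec, Matrix.vecMulVec_smul]

theorem ketbra_posSemidef (ψ : a → ℂ) : (ketbra ψ).PosSemidef :=
  Matrix.posSemidef_vecMulVec_self_star ψ

variable [DecidableEq a]

theorem sqrt_ketbra (ψ : a → ℂ) :
    CFC.sqrt (ketbra ψ) = (((Real.sqrt (star ψ ⬝ᵥ ψ).re)⁻¹ : ℝ) : ℂ) • ketbra ψ := by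
  apply CFC.sqrt_unique
  · rw [smul_mul_smul_comm, ketbra_mul_ketbra, star_dotProduct_self_eq_ofReal, smul_smul,
      Complex.ofReal_re]
    have hq := star_dotProduct_self_re_nonneg ψ
    rcases hq.eq_or_lt with h0 | h0
    -- For `ψ = 0` the scalar is `0⁻¹ = 0`, which is harmless because the operator vanishes too.
    · have : star ψ ⬝ᵥ ψ = 0 := by rw [star_dotProduct_self_eq_ofReal, ← h0]; rfl
      rw [dotProduct_star_self_eq_zero] at this
      simp [this, ketbra]
    · rw [← Complex.ofReal_mul, ← Complex.ofReal_mul, ← mul_inv, Real.mul_self_sqrt hq,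
        inv_mul_cancel₀ h0.ne', Complex.ofReal_one, one_smul]
  · rw [Matrix.nonneg_iff_posSemidef]
    exact (ketbra_posSemidef ψ).smul (by
      rw [Complex.zero_le_real]; positivity)

theorem trace_sqrt_ketbra_sq (ψ : a → ℂ) :
    (CFC.sqrt (ketbra ψ)).trace.re ^ 2 = (star ψ ⬝ᵥ ψ).re := by
  have hq := star_dotProduct_self_re_nonneg ψ
  rw [sqrt_ketbra, Matrix.trace_smul, trace_ketbra, star_dotProduct_self_eq_ofReal, smul_eq_mul,
    ← Complex.ofReal_mul, Complex.ofReal_re, Complex.ofReal_re, mul_pow, inv_pow, Real.sq_sqrt hq]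
  rcases hq.eq_or_lt with h0 | h0
  · simp [← h0]
  · field_simp

/-- `√σ |φ⟩⟨φ| √σ` is the rank-one operator of `√σ φ`, so the squared trace of its root is `‖√σ
φ‖²`. No normalization of `φ` is needed. -/
theorem fidelity_ketbra_right {σ : Matrix a a ℂ} (hσ : σ.PosSemidef) (φ : a → ℂ) :
    fidelity σ (ketbra φ) = (star φ ⬝ᵥ σ *ᵥ φ).re := by
  have ht : (CFC.sqrt σ)ᴴ = CFC.sqrt σ :=
    (Matrix.nonneg_iff_posSemidef.1 (CFC.sqrt_nonneg σ)).isHermitian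
  have h1 : CFC.sqrt σ * ketbra φ * CFC.sqrt σ = ketbra (CFC.sqrt σ *ᵥ φ) := by
    rw [ketbra, ketbra, Matrix.mul_vecMulVec, Matrix.vecMulVec_mul, Matrix.star_mulVec, ht]
  rw [fidelity, h1, trace_sqrt_ketbra_sq, Matrix.star_mulVec, ht, ← Matrix.dotProduct_mulVec,
    Matrix.mulVec_mulVec, CFC.sqrt_mul_sqrt_self σ (Matrix.nonneg_iff_posSemidef.2 hσ)]

/-- A unit `|φ⟩⟨φ|` is its own square root, and sandwiching `σ` with it rescales it by `⟨φ|σ|φ⟩`. -/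
theorem fidelity_ketbra_left {σ : Matrix a a ℂ} (hσ : σ.PosSemidef) {φ : a → ℂ}
    (hφ : star φ ⬝ᵥ φ = 1) : fidelity (ketbra φ) σ = (star φ ⬝ᵥ σ *ᵥ φ).re := by
  have hq : 0 ≤ star φ ⬝ᵥ σ *ᵥ φ := hσ.dotProduct_mulVec_nonneg φ
  have hqr : star φ ⬝ᵥ σ *ᵥ φ = (((star φ ⬝ᵥ σ *ᵥ φ).re : ℝ) : ℂ) :=
    Complex.eq_re_of_ofReal_le (r := 0) (by simpa using hq)
  have h0 : 0 ≤ (star φ ⬝ᵥ σ *ᵥ φ).re := (Complex.le_def.1 hq).1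
  have h1 : ketbra φ * σ * ketbra φ =
      ketbra (((Real.sqrt (star φ ⬝ᵥ σ *ᵥ φ).re : ℝ) : ℂ) • φ) := by
    have hs : ((Real.sqrt (star φ ⬝ᵥ σ *ᵥ φ).re : ℝ) : ℂ) *
        ((Real.sqrt (star φ ⬝ᵥ σ *ᵥ φ).re : ℝ) : ℂ) = star φ ⬝ᵥ σ *ᵥ φ := by
      rw [← Complex.ofReal_mul, Real.mul_self_sqrt h0, ← hqr]
    rw [ketbra, ketbra, Matrix.mul_assoc, Matrix.mul_vecMulVec, Matrix.vecMulVec_mul_vecMulVec,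
      star_smul, Matrix.vecMulVec_smul, Matrix.vecMulVec_smul, Matrix.smul_vecMulVec, smul_smul,
      Complex.star_def, Complex.conj_ofReal, hs]
  rw [fidelity, sqrt_ketbra, hφ]
  simp only [Complex.one_re, Real.sqrt_one, inv_one, Complex.ofReal_one, one_smul]
  rw [h1, trace_sqrt_ketbra_sq, star_smul, smul_dotProduct, dotProduct_smul, hφ,
    Complex.star_def, Complex.conj_ofReal, smul_eq_mul, smul_eq_mul, mul_one, ← Complex.ofReal_mul,
    Complex.ofReal_re, Real.mul_self_sqrt h0]

end PureFidelity

/-! ### Optimal recovery for flat states -/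

section Recovery

variable {r e : Type} [Fintype r] [DecidableEq r] [Fintype e]

/-- Makes the fidelity with `Φ` a linear functional of the recovered state, computable block by
block. -/
theorem star_maxEntangled_dotProduct (X : Matrix (r × r) (r × r) ℂ) :
    star (maxEntangled r) ⬝ᵥ X *ᵥ maxEntangled r =
      (Fintype.card r : ℂ)⁻¹ * ∑ i, ∑ j, X (i, i) (j, j) := by
  have hs : ((Real.sqrt (Fintype.card r) : ℝ) : ℂ) * ((Real.sqrt (Fintype.card r) : ℝ) : ℂ) =
      (Fintype.card r : ℂ) := by
    rw [← Complex.ofReal_mul, Real.mul_self_sqrt (Nat.cast_nonneg _), Complex.ofReal_natCast]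
  simp only [dotProduct, Matrix.mulVec, maxEntangled, Fintype.sum_prod_type, Pi.star_apply,
    mul_ite, mul_zero, Finset.sum_ite_eq, Finset.mem_univ, if_true, apply_ite star, star_zero,
    ite_mul, zero_mul]
  rw [← hs, Finset.mul_sum]
  refine Finset.sum_congr rfl fun i _ => ?_
  rw [← Finset.sum_mul]
  simp
  ring

theorem star_maxEntangled_dotProduct_self [Nonempty r] :
    star (maxEntangled r) ⬝ᵥ maxEntangled r = 1 := by
  have h := star_maxEntangled_dotProduct (1 : Matrix (r × r) (r × r) ℂ)
  rw [Matrix.one_mulVec] at h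
  rw [h]
  simp [Matrix.one_apply]

/-- The partial trace over the first factor. -/
def traceLeft {x y : Type} [Fintype x] (ρ : Matrix (x × y) (x × y) ℂ) : Matrix y y ℂ :=
  Matrix.of fun a b => ∑ i, ρ (i, a) (i, b)

theorem trace_traceLeft {x y : Type} [Fintype x] [Fintype y] (ρ : Matrix (x × y) (x × y) ℂ) :
    (traceLeft ρ).trace = ρ.trace := by
  simp only [traceLeft, Matrix.trace, Matrix.diag_apply, Matrix.of_apply, Fintype.sum_prod_type]
  exact Finset.sum_comm

theorem traceLeft_one_kronecker_mul {x y : Type} [Fintype x] [DecidableEq x] [Fintype y]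
    (A : Matrix y y ℂ) (ρ : Matrix (x × y) (x × y) ℂ) :
    traceLeft (((1 : Matrix x x ℂ) ⊗ₖ A) * ρ) = A * traceLeft ρ := by
  ext a b
  simp only [traceLeft, Matrix.of_apply, Matrix.mul_apply, Fintype.sum_prod_type,
    Matrix.kroneckerMap_apply, Matrix.one_apply, ite_mul, one_mul, zero_mul, Finset.mul_sum,
    Finset.sum_ite_irrel, Finset.sum_const_zero, Finset.sum_ite_eq, Finset.mem_univ, if_true]
  exact Finset.sum_comm

/-- The map whose Choi matrix is `D`. -/
noncomputable def choiMap {f : Type} (D : Matrix (f × e) (f × e) ℂ) :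
    Matrix e e ℂ →ₗ[ℂ] Matrix f f ℂ where
  toFun X := Matrix.of fun i j => ∑ x, ∑ y, D (i, x) (j, y) * X x y
  map_add' X Y := by
    ext i j
    simp [mul_add, Finset.sum_add_distrib]
  map_smul' c X := by
    ext i j
    simp [Finset.mul_sum, mul_left_comm]

/-- Complete positivity holds because the extended map is `ρ ↦ W (ρ ⊗ D) Wᴴ`; the marginal condition
on `D` is trace preservation. -/
theorem isChannel_choiMap [DecidableEq e] {D : Matrix (r × e) (r × e) ℂ} (hD : D.PosSemidef)
    (htr : traceLeft D = 1) : IsChannel (choiMap D) where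
  completely_positive s _ ρ hρ := by
    classical
    have := Fintype.ofFinite s
    -- `W` contracts the two copies of `e` with the unnormalized bra `∑ x, ⟨x|⟨x|`.
    let W : Matrix (s × r) ((s × e) × (r × e)) ℂ :=
      Matrix.of fun p q => if p.1 = q.1.1 ∧ p.2 = q.2.1 ∧ q.1.2 = q.2.2 then 1 else 0
    have hW : idTensor s (choiMap D) ρ = W * (ρ ⊗ₖ D) * Wᴴ := by
      ext ⟨a, i⟩ ⟨b, j⟩
      simp only [idTensor, choiMap, LinearMap.coe_mk, AddHom.coe_mk, Matrix.of_apply, W,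
        Matrix.mul_apply, Matrix.conjTranspose_apply, Matrix.kroneckerMap_apply,
        Fintype.sum_prod_type, ite_and, apply_ite star, star_one, star_zero, ite_mul, mul_ite,
        one_mul, mul_one, zero_mul, mul_zero, Finset.sum_ite_irrel, Finset.sum_const_zero,
        Finset.sum_ite_eq, Finset.mem_univ, if_true]
      rw [Finset.sum_comm]
      refine Finset.sum_congr rfl fun y _ => Finset.sum_congr rfl fun x _ => mul_comm _ _
    rw [hW]
    exact (hρ.kronecker hD).mul_mul_conjTranspose_same W
  trace_preserving X := by
    have h : ∀ x y, ∑ i, D (i, x) (i, y) = (1 : Matrix e e ℂ) x y := fun x y => by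
      rw [← htr]; rfl
    simp only [choiMap, LinearMap.coe_mk, AddHom.coe_mk, Matrix.trace, Matrix.diag_apply,
      Matrix.of_apply]
    rw [Finset.sum_comm]
    refine Finset.sum_congr rfl fun x _ => ?_
    rw [Finset.sum_comm]
    simp [← Finset.sum_mul, h, Matrix.one_apply]

theorem idTensor_sub {r e f : Type} (Φ : Matrix e e ℂ →ₗ[ℂ] Matrix f f ℂ)
    (ρ σ : Matrix (r × e) (r × e) ℂ) :
    idTensor r Φ (ρ - σ) = idTensor r Φ ρ - idTensor r Φ σ := by
  ext p q
  exact congrFun (congrFun (map_sub Φ (Matrix.of fun x y => ρ (p.1, x) (q.1, y))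
    (Matrix.of fun x y => σ (p.1, x) (q.1, y))) p.2) q.2

theorem idTensor_smul {r e f : Type} (Φ : Matrix e e ℂ →ₗ[ℂ] Matrix f f ℂ) (c : ℂ)
    (ρ : Matrix (r × e) (r × e) ℂ) : idTensor r Φ (c • ρ) = c • idTensor r Φ ρ := by
  ext p q
  exact congrFun (congrFun (map_smul Φ c (Matrix.of fun x y => ρ (p.1, x) (q.1, y))) p.2) q.2

/-- The output is `1 ⊗ Φ(σ)`, whose overlap depends only on the preserved trace. This makes the
upper bound the same for all channels. -/
theorem star_maxEntangled_dotProduct_idTensor_one_kronecker [Nonempty r]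
    {Φ : Matrix e e ℂ →ₗ[ℂ] Matrix r r ℂ} (hΦ : IsChannel Φ) (σ : Matrix e e ℂ) :
    star (maxEntangled r) ⬝ᵥ idTensor r Φ ((1 : Matrix r r ℂ) ⊗ₖ σ) *ᵥ maxEntangled r =
      (Fintype.card r : ℂ)⁻¹ * σ.trace := by
  rw [star_maxEntangled_dotProduct, ← hΦ.trace_preserving]
  congr 1
  refine Finset.sum_congr rfl fun i _ => ?_
  have h : ∀ j, idTensor r Φ ((1 : Matrix r r ℂ) ⊗ₖ σ) (i, i) (j, j) =
      if i = j then Φ σ i i else 0 := by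
    intro j
    have : (Matrix.of fun x y => ((1 : Matrix r r ℂ) ⊗ₖ σ) (i, x) (j, y)) =
        if i = j then σ else 0 := by
      ext x y
      by_cases h : i = j <;> simp [h]
    simp only [idTensor, Matrix.of_apply]
    rw [this]
    split_ifs with h
    · rw [h]
    · simp
  simp [h]

theorem Matrix.posSemidef_of_isHermitian_of_mul_self {m : Type} [Fintype m] {P : Matrix m m ℂ}
    (h : P.IsHermitian) (h2 : P * P = P) : P.PosSemidef := by
  rw [← h2]
  nth_rw 2 [← h.eq]
  exact Matrix.posSemidef_self_mul_conjTranspose P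

theorem traceLeft_isHermitian {x y : Type} [Fintype x] {ρ : Matrix (x × y) (x × y) ℂ}
    (h : ρ.IsHermitian) : (traceLeft ρ).IsHermitian := by
  ext a b
  simp only [traceLeft, Matrix.conjTranspose_apply, Matrix.of_apply, star_sum, h.apply]

/-- The support of a state lies in the support of its marginal. -/
theorem one_kronecker_mul_eq_zero {κ : Type} [Fintype κ] (K : Matrix (r × e) κ ℂ)
    {Q : Matrix e e ℂ} (hQ : Q * traceLeft (K * Kᴴ) = 0) :
    ((1 : Matrix r r ℂ) ⊗ₖ Q) * K = 0 := by
  -- The squared Hilbert–Schmidt norm of `(1 ⊗ Q) K` is `tr(Qᴴ Q tr_R(K Kᴴ))`, which vanishes by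
  -- `hQ`.
  rw [← Matrix.trace_mul_conjTranspose_self_eq_zero_iff, Matrix.conjTranspose_mul,
    ← Matrix.mul_assoc, Matrix.trace_mul_comm, Matrix.conjTranspose_kronecker,
    Matrix.conjTranspose_one, Matrix.mul_assoc _ K, ← Matrix.mul_assoc, ← trace_traceLeft]
  rw [← Matrix.mul_kronecker_mul, Matrix.mul_one, traceLeft_one_kronecker_mul, Matrix.mul_assoc,
    hQ, Matrix.mul_zero, Matrix.trace_zero]

/-- A state proportional to a projector, with marginal proportional to a projector, has
recovery fidelity given by the ratio of the two eigenvalues. -/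
theorem isGreatest_fidelity_of_flat [Nonempty r] [DecidableEq e] {κ : Type} [Fintype κ]
    {ρ : Matrix (r × e) (r × e) ℂ} (K : Matrix (r × e) κ ℂ) (hK : ρ = K * Kᴴ) {c c' : ℝ}
    (hc : 0 < c) (hc' : 0 < c') (hρ : ρ * ρ = (c : ℂ) • ρ)
    (hσ : traceLeft ρ * traceLeft ρ = (c' : ℂ) • traceLeft ρ) (htr : ρ.trace = 1) :
    IsGreatest {F : ℝ | ∃ 𝓡 : Matrix e e ℂ →ₗ[ℂ] Matrix r r ℂ, IsChannel 𝓡 ∧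
      F = fidelity (ketbra (maxEntangled r)) (idTensor r 𝓡 ρ)} (c / (c' * Fintype.card r)) := by
  have hcC : (c : ℂ) ≠ 0 := by exact_mod_cast hc.ne'
  have hc'C : (c' : ℂ) ≠ 0 := by exact_mod_cast hc'.ne'
  have hrC : (Fintype.card r : ℂ) ≠ 0 := by exact_mod_cast Fintype.card_ne_zero
  have hpos : ρ.PosSemidef := hK ▸ Matrix.posSemidef_self_mul_conjTranspose K
  have hF : ∀ 𝓡 : Matrix e e ℂ →ₗ[ℂ] Matrix r r ℂ, IsChannel 𝓡 →
      fidelity (ketbra (maxEntangled r)) (idTensor r 𝓡 ρ) =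
        (star (maxEntangled r) ⬝ᵥ idTensor r 𝓡 ρ *ᵥ maxEntangled r).re := fun 𝓡 h𝓡 =>
    fidelity_ketbra_left (h𝓡.completely_positive r ρ hpos) star_maxEntangled_dotProduct_self
  set σ := traceLeft ρ with hσdef
  set P : Matrix e e ℂ := (c' : ℂ)⁻¹ • σ with hP
  have hσh : σ.IsHermitian := traceLeft_isHermitian hpos.isHermitian
  have hPh : P.IsHermitian := by
    rw [Matrix.IsHermitian, hP, Matrix.conjTranspose_smul, hσh.eq]
    simp
  have hPP : P * P = P := by
    rw [hP, smul_mul_smul_comm, hσ, smul_smul, mul_assoc, inv_mul_cancel₀ hc'C, mul_one]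
  have hQ : (1 - P) * σ = 0 := by
    rw [sub_mul, one_mul, hP, Matrix.smul_mul, hσ, smul_smul, inv_mul_cancel₀ hc'C, one_smul,
      sub_self]
  have hQρ : ((1 : Matrix r r ℂ) ⊗ₖ (1 - P)) * ρ = 0 := by
    rw [hK, ← Matrix.mul_assoc, one_kronecker_mul_eq_zero K (hK ▸ hQ), Matrix.zero_mul]
  have hPρ : ((1 : Matrix r r ℂ) ⊗ₖ P) * ρ = ρ := by
    have hsub : ((1 : Matrix r r ℂ) ⊗ₖ (1 - P)) = 1 ⊗ₖ 1 - 1 ⊗ₖ P :=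
      Matrix.ext fun p q => mul_sub _ _ _
    rw [hsub, Matrix.one_kronecker_one, sub_mul, one_mul, sub_eq_zero] at hQρ
    exact hQρ.symm
  have hQh : (1 - P).IsHermitian := Matrix.isHermitian_one.sub hPh
  have hQpos : (1 - P).PosSemidef :=
    Matrix.posSemidef_of_isHermitian_of_mul_self hQh (by
      rw [sub_mul, mul_sub, mul_sub, hPP]; simp)
  have htrσ : σ.trace = 1 := by rw [hσdef, trace_traceLeft, htr]
  constructor
  -- The marginal of `C` is `P + (1 - P) = 1`. The second summand serves only this purpose, since it
  -- annihilates `ρ`. The transpose below turns the Choi pairing into `tr(C ρ)`.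
  · set C : Matrix (r × e) (r × e) ℂ := (c' : ℂ)⁻¹ • ρ +
      (Fintype.card r : ℂ)⁻¹ • ((1 : Matrix r r ℂ) ⊗ₖ (1 - P)) with hC
    have hCpos : C.PosSemidef := by
      refine (hpos.smul ?_).add ((Matrix.PosSemidef.one.kronecker hQpos).smul ?_)
      · rw [← Complex.ofReal_inv, Complex.zero_le_real]; positivity
      · rw [← Complex.ofReal_natCast, ← Complex.ofReal_inv, Complex.zero_le_real]; positivity
    have hCtr : traceLeft Cᵀ = 1 := by
      ext x y
      have h1 : (∑ i, ρ (i, y) (i, x)) = σ y x := rfl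
      simp only [traceLeft, Matrix.of_apply, Matrix.transpose_apply, hC, Matrix.add_apply,
        Matrix.smul_apply, Matrix.kroneckerMap_apply, Matrix.one_apply_eq, one_mul,
        Finset.sum_add_distrib, smul_eq_mul, ← Finset.mul_sum, h1, Finset.sum_const,
        Finset.card_univ, nsmul_eq_mul]
      rw [inv_mul_cancel_left₀ hrC, Matrix.sub_apply, hP, Matrix.smul_apply, smul_eq_mul,
        add_sub_cancel, Matrix.one_apply, Matrix.one_apply]
      simp [eq_comm]
    have hch := isChannel_choiMap hCpos.transpose hCtr
    refine ⟨_, hch, ?_⟩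
    rw [hF _ hch, star_maxEntangled_dotProduct]
    have hsum : ∑ i, ∑ j, idTensor r (choiMap Cᵀ) ρ (i, i) (j, j) = (C * ρ).trace := by
      simp only [idTensor, choiMap, LinearMap.coe_mk, AddHom.coe_mk, Matrix.of_apply,
        Matrix.transpose_apply, Matrix.trace, Matrix.diag_apply, Matrix.mul_apply,
        Fintype.sum_prod_type]
      rw [Finset.sum_comm]
      refine Finset.sum_congr rfl fun j _ => ?_
      conv_rhs => rw [Finset.sum_comm]
      refine Finset.sum_congr rfl fun i _ => ?_
      exact Finset.sum_comm
    rw [hsum, hC, add_mul, Matrix.smul_mul, Matrix.smul_mul, hQρ, smul_zero, add_zero, hρ,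
      Matrix.trace_smul, Matrix.trace_smul, htr, smul_eq_mul, smul_eq_mul, mul_one,
      ← Complex.ofReal_natCast, ← Complex.ofReal_inv, ← Complex.ofReal_inv, ← Complex.ofReal_mul,
      ← Complex.ofReal_mul, Complex.ofReal_re]
    field_simp
  · rintro F ⟨𝓡, h𝓡, rfl⟩
    rw [hF 𝓡 h𝓡]
    -- `ρ/c` is a projector under the projector `1 ⊗ P`, so their difference is a projector.
    have hTpos : ((1 : Matrix r r ℂ) ⊗ₖ P - (c : ℂ)⁻¹ • ρ).PosSemidef := by
      have hPr : ((1 : Matrix r r ℂ) ⊗ₖ P).IsHermitian := by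
        rw [Matrix.IsHermitian, Matrix.conjTranspose_kronecker, Matrix.conjTranspose_one, hPh.eq]
      have hρP : ρ * ((1 : Matrix r r ℂ) ⊗ₖ P) = ρ := by
        have := congrArg Matrix.conjTranspose hPρ
        rwa [Matrix.conjTranspose_mul, hPr.eq, hpos.isHermitian.eq] at this
      apply Matrix.posSemidef_of_isHermitian_of_mul_self
      · refine hPr.sub ?_
        rw [Matrix.IsHermitian, Matrix.conjTranspose_smul, hpos.isHermitian.eq]
        simp
      · rw [sub_mul, mul_sub, mul_sub, Matrix.smul_mul, Matrix.smul_mul, Matrix.mul_smul,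
          Matrix.mul_smul, hPρ, hρP, hρ, smul_smul (c : ℂ)⁻¹ (c : ℂ), inv_mul_cancel₀ hcC, one_smul,
          ← Matrix.mul_kronecker_mul, one_mul, hPP, sub_self, sub_zero]
    have h0 := (h𝓡.completely_positive r _ hTpos).dotProduct_mulVec_nonneg (maxEntangled r)
    rw [idTensor_sub, idTensor_smul, Matrix.sub_mulVec, dotProduct_sub, Matrix.smul_mulVec,
      dotProduct_smul, star_maxEntangled_dotProduct_idTensor_one_kronecker h𝓡, hP,
      Matrix.trace_smul, htrσ, smul_eq_mul, smul_eq_mul, mul_one] at h0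
    have h1 := (Complex.le_def.1 h0).1
    rw [← Complex.ofReal_natCast, ← Complex.ofReal_inv, ← Complex.ofReal_inv, ← Complex.ofReal_inv,
      ← Complex.ofReal_mul, Complex.sub_re, Complex.re_ofReal_mul, Complex.ofReal_re,
      Complex.zero_re, sub_nonneg, inv_mul_le_iff₀ hc] at h1
    refine h1.trans_eq ?_
    field_simp

end Recovery

/-! ### Commutation and supports of Pauli operators -/

section Pauli

variable {n : ℕ}

/-- The sign with which two Pauli matrices commute. -/
def pauliSign (s t : Fin 4) : ℂ := if s = 0 ∨ t = 0 ∨ s = t then 1 else -1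

theorem pauliMatrix_mul_comm (s t : Fin 4) :
    pauliMatrix s * pauliMatrix t = pauliSign s t • (pauliMatrix t * pauliMatrix s) := by
  fin_cases s <;> fin_cases t <;>
    (ext i j; fin_cases i <;> fin_cases j <;>
      simp [pauliMatrix, pauliSign, Matrix.mul_apply, Fin.sum_univ_two, Matrix.one_apply])

theorem trace_pauliMatrix (s : Fin 4) : (pauliMatrix s).trace = if s = 0 then 2 else 0 := by
  fin_cases s <;> simp [pauliMatrix, Matrix.trace, Fin.sum_univ_two]

theorem trace_pauliMatrix_mul (s t : Fin 4) :
    (pauliMatrix s * pauliMatrix t).trace = if s = t then 2 else 0 := by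
  fin_cases s <;> fin_cases t <;>
    simp [pauliMatrix, Matrix.trace, Fin.sum_univ_two] <;> norm_num

theorem pauliMatrix_conjTranspose (s : Fin 4) : (pauliMatrix s)ᴴ = pauliMatrix s := by
  fin_cases s <;>
    (ext i j; fin_cases i <;> fin_cases j <;> simp [pauliMatrix])

theorem pauliString_mul_comm (P Q : Fin n → Fin 4) :
    pauliString P * pauliString Q =
      (∏ j, pauliSign (P j) (Q j)) • (pauliString Q * pauliString P) := by
  ext a b
  rw [Matrix.smul_apply, pauliString_mul_apply, pauliString_mul_apply, smul_eq_mul,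
    ← Finset.prod_mul_distrib]
  refine Finset.prod_congr rfl fun j _ => ?_
  rw [pauliMatrix_mul_comm, Matrix.smul_apply, smul_eq_mul]

theorem trace_pauliString_mul (P Q : Fin n → Fin 4) :
    (pauliString P * pauliString Q).trace = if P = Q then 2 ^ n else 0 := by
  have h : (pauliString P * pauliString Q).trace =
      ∏ j, (pauliMatrix (P j) * pauliMatrix (Q j)).trace := by
    simp only [Matrix.trace, Matrix.diag_apply, pauliString_mul_apply]
    rw [Finset.prod_univ_sum, Fintype.piFinset_univ]
  rw [h]
  simp only [trace_pauliMatrix_mul]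
  rw [Finset.prod_ite_zero]
  simp [funext_iff]

theorem pauliString_ne_zero (P : Fin n → Fin 4) : pauliString P ≠ 0 := by
  intro h
  have := pauliString_mul_self P
  rw [h, Matrix.zero_mul] at this
  exact zero_ne_one this

theorem pauliString_conjTranspose (P : Fin n → Fin 4) : (pauliString P)ᴴ = pauliString P := by
  ext a b
  simp only [Matrix.conjTranspose_apply, pauliString, Matrix.of_apply, star_prod]
  refine Finset.prod_congr rfl fun j _ => ?_
  rw [← Matrix.conjTranspose_apply, pauliMatrix_conjTranspose]

theorem pauliString_isUnitary (P : Fin n → Fin 4) :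
    pauliString P ∈ Matrix.unitaryGroup (Bits (Fin n)) ℂ := by
  rw [Matrix.mem_unitaryGroup_iff, Matrix.star_eq_conjTranspose, pauliString_conjTranspose,
    pauliString_mul_self]

/-- Distinct Pauli strings are Hilbert–Schmidt orthogonal, so a Pauli operator determines its
string, and then its phase. -/
theorem smul_pauliString_inj {c d : ℕ} {P Q : Fin n → Fin 4}
    (h : Complex.I ^ c • pauliString P = Complex.I ^ d • pauliString Q) :
    Complex.I ^ c = Complex.I ^ d ∧ P = Q := by
  have hPQ : P = Q := by
    by_contra hne
    have h1 := congrArg (fun X => (pauliString P * X).trace) h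
    simp only [Matrix.mul_smul, Matrix.trace_smul, trace_pauliString_mul, if_neg hne, if_true,
      smul_zero] at h1
    simp at h1
  subst hPQ
  exact ⟨smul_left_injective ℂ (pauliString_ne_zero P) h, rfl⟩

theorem I_pow_fin_injective : Function.Injective fun c : Fin 4 => Complex.I ^ (c : ℕ) := by
  intro c d h
  fin_cases c <;> fin_cases d <;> simp [Complex.ext_iff, Complex.I_pow_three] at h ⊢ <;> norm_num at h

theorem I_pow_mod_four (c : ℕ) : Complex.I ^ (c % 4) = Complex.I ^ c := by
  conv_rhs => rw [← Nat.div_add_mod c 4, pow_add, pow_mul, Complex.I_pow_four, one_pow, one_mul]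

theorem pauliOn_mono {A B : Finset (Fin n)} (h : A ⊆ B) : pauliOn A ≤ pauliOn B := by
  rintro U ⟨c, P, hP, hU⟩
  exact ⟨c, P, fun j hj => hP j fun hA => hj (h hA), hU⟩

theorem card_pauliOn (A : Finset (Fin n)) : Nat.card (pauliOn A) = 4 * 4 ^ A.card := by
  let ext0 : ({j // j ∈ A} → Fin 4) → Fin n → Fin 4 :=
    fun f j => if h : j ∈ A then f ⟨j, h⟩ else 0
  have hmem : ∀ (c : Fin 4) f, Complex.I ^ (c : ℕ) • pauliString (ext0 f) ∈
      Matrix.unitaryGroup (Bits (Fin n)) ℂ := by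
    intro c f
    rw [Matrix.mem_unitaryGroup_iff, Matrix.star_eq_conjTranspose, Matrix.conjTranspose_smul,
      smul_mul_smul_comm, pauliString_conjTranspose, pauliString_mul_self, star_pow, ← mul_pow]
    simp
  let g : Fin 4 × ({j // j ∈ A} → Fin 4) → pauliOn A := fun p =>
    ⟨⟨_, hmem p.1 p.2⟩, p.1, ext0 p.2, fun j hj => dif_neg hj, rfl⟩
  have hg : Function.Bijective g := by
    constructor
    · rintro ⟨c, f⟩ ⟨d, f'⟩ h
      obtain ⟨h1, h2⟩ := smul_pauliString_inj (congrArg (fun x => x.1.1) h)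
      refine Prod.ext (I_pow_fin_injective h1) (funext fun j => ?_)
      have := congrFun h2 j.1
      simpa [ext0] using this
    · rintro ⟨U, c, P, hP, hU⟩
      refine ⟨(⟨c % 4, Nat.mod_lt _ (by norm_num)⟩, fun j => P j), Subtype.ext (Subtype.ext ?_)⟩
      have : ext0 (fun j => P j) = P := by
        funext j
        by_cases hj : j ∈ A
        · simp [ext0, hj]
        · simp [ext0, hj, hP j hj]
      change Complex.I ^ (c % 4) • pauliString (ext0 fun j => P j) = U
      rw [this, I_pow_mod_four, hU]
  rw [← Nat.card_eq_of_bijective g hg, Nat.card_eq_fintype_card]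
  simp

instance pauliOn_finite (A : Finset (Fin n)) : Finite (pauliOn A) :=
  Nat.finite_of_card_ne_zero (by rw [card_pauliOn]; positivity)

theorem QubitUnitary.neg_ne (U : QubitUnitary n) : -U ≠ U := by
  intro h
  have h1 : -(U : Matrix (Bits (Fin n)) (Bits (Fin n)) ℂ) = U := congrArg Subtype.val h
  have h0 : (U : Matrix (Bits (Fin n)) (Bits (Fin n)) ℂ) = 0 := by
    ext a b
    exact self_eq_neg.1 (congrFun (congrFun h1.symm a) b)
  have h2 : (1 : Matrix (Bits (Fin n)) (Bits (Fin n)) ℂ) = 0 := by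
    rw [← (Matrix.mem_unitaryGroup_iff.1 U.2), h0, Matrix.zero_mul]
  exact one_ne_zero h2

theorem prod_pauliSign_eq (P Q : Fin n → Fin 4) :
    (∏ j, pauliSign (P j) (Q j)) = 1 ∨ (∏ j, pauliSign (P j) (Q j)) = -1 := by
  refine Finset.prod_induction _ (fun x => x = 1 ∨ x = -1) ?_ (Or.inl rfl) ?_
  · rintro a b (rfl | rfl) (rfl | rfl) <;> simp
  · intro j _
    unfold pauliSign
    split_ifs <;> simp

theorem coe_mul_comm_of_eq {U W : QubitUnitary n} {c d : ℕ} {P Q : Fin n → Fin 4}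
    (hU : (U : Matrix (Bits (Fin n)) (Bits (Fin n)) ℂ) = Complex.I ^ c • pauliString P)
    (hW : (W : Matrix (Bits (Fin n)) (Bits (Fin n)) ℂ) = Complex.I ^ d • pauliString Q) :
    ((U * W : QubitUnitary n) : Matrix (Bits (Fin n)) (Bits (Fin n)) ℂ) =
      (∏ j, pauliSign (P j) (Q j)) • ((W * U : QubitUnitary n) :
        Matrix (Bits (Fin n)) (Bits (Fin n)) ℂ) := by
  rw [Submonoid.coe_mul, Submonoid.coe_mul, hU, hW, smul_mul_smul_comm, pauliString_mul_comm,
    smul_mul_smul_comm, smul_smul, smul_smul]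
  congr 1
  ring

theorem pauli_commute_or_anticommute {U W : QubitUnitary n} (hU : U ∈ pauliGroup n)
    (hW : W ∈ pauliGroup n) : U * W = W * U ∨ U * W = -(W * U) := by
  obtain ⟨c, P, -, hU⟩ := hU
  obtain ⟨d, Q, -, hW⟩ := hW
  have h := coe_mul_comm_of_eq hU hW
  rcases prod_pauliSign_eq P Q with h1 | h1
  · exact Or.inl (Subtype.ext (by rw [h, h1, one_smul]))
  · exact Or.inr (Subtype.ext (by rw [h, h1, neg_one_smul]; rfl))

open Classical in
/-- The sign with which two unitaries commute. -/
noncomputable def commSign (U W : QubitUnitary n) : ℤ := if U * W = W * U then 1 else -1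

theorem commSign_comm (U W : QubitUnitary n) : commSign U W = commSign W U := by
  unfold commSign
  simp only [eq_comm]

theorem commSign_eq_one_iff {U W : QubitUnitary n} : commSign U W = 1 ↔ U * W = W * U := by
  unfold commSign
  split_ifs with h <;> simp [h]

theorem commSign_of_anticommute {U W : QubitUnitary n} (h : U * W = -(W * U)) :
    commSign U W = -1 := by
  unfold commSign
  rw [if_neg]
  intro h'
  exact QubitUnitary.neg_ne (W * U) (by rw [← h, h'])

theorem commSign_mul {U W W' : QubitUnitary n} (hU : U ∈ pauliGroup n) (hW : W ∈ pauliGroup n)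
    (hW' : W' ∈ pauliGroup n) : commSign U (W * W') = commSign U W * commSign U W' := by
  rcases pauli_commute_or_anticommute hU hW with h | h <;>
    rcases pauli_commute_or_anticommute hU hW' with h' | h'
  · rw [commSign_eq_one_iff.2 h, commSign_eq_one_iff.2 h', commSign_eq_one_iff.2, one_mul]
    rw [← mul_assoc, h, mul_assoc, h', mul_assoc]
  · rw [commSign_eq_one_iff.2 h, commSign_of_anticommute h', commSign_of_anticommute, one_mul]
    rw [← mul_assoc, h, mul_assoc, h', mul_neg, mul_assoc]
  · rw [commSign_of_anticommute h, commSign_eq_one_iff.2 h', commSign_of_anticommute, mul_one]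
    rw [← mul_assoc, h, neg_mul, mul_assoc, h', mul_assoc]
  · rw [commSign_of_anticommute h, commSign_of_anticommute h', commSign_eq_one_iff.2]
    · norm_num
    · rw [← mul_assoc, h, neg_mul, mul_assoc, h', mul_neg, neg_neg, mul_assoc]

/-- The character of a group of Pauli operators given by commutation with a Pauli operator. -/
noncomputable def commChar (H : Subgroup (QubitUnitary n)) (hH : H ≤ pauliGroup n)
    {U : QubitUnitary n} (hU : U ∈ pauliGroup n) : H →* ℤ where
  toFun W := commSign U W
  map_one' := commSign_eq_one_iff.2 (by simp)
  map_mul' W W' := commSign_mul hU (hH W.2) (hH W'.2)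

open Classical in
-- Commutation with `U` is a `±1`-valued character of `H`, and a nontrivial character sums to zero.
theorem sum_commSign (H : Subgroup (QubitUnitary n)) (hH : H ≤ pauliGroup n) [Fintype H]
    {U : QubitUnitary n} (hU : U ∈ pauliGroup n) :
    ∑ W : H, commSign U W = if ∀ W ∈ H, U * W = W * U then (Nat.card H : ℤ) else 0 := by
  have h := sum_hom_units (commChar H hH hU)
  have hiff : commChar H hH hU = 1 ↔ ∀ W ∈ H, U * W = W * U := by
    constructor
    · intro h W hW
      exact commSign_eq_one_iff.1 (DFunLike.congr_fun h ⟨W, hW⟩)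
    · intro h
      ext W
      exact commSign_eq_one_iff.2 (h W W.2)
  rw [Nat.card_eq_fintype_card]
  simp only [hiff, Nat.cast_ite, Nat.cast_zero] at h
  exact h

/-- Double counting of commuting pairs in two groups of Pauli operators. -/
theorem card_mul_card_commuting {H K : Subgroup (QubitUnitary n)} (hH : H ≤ pauliGroup n)
    (hK : K ≤ pauliGroup n) :
    Nat.card K * Nat.card (H ⊓ Subgroup.centralizer (K : Set (QubitUnitary n)) :
        Subgroup (QubitUnitary n)) =
      Nat.card H * Nat.card (K ⊓ Subgroup.centralizer (H : Set (QubitUnitary n)) :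
        Subgroup (QubitUnitary n)) := by
  classical
  have : Finite H := Finite.of_injective _ (Subgroup.inclusion_injective hH)
  have : Finite K := Finite.of_injective _ (Subgroup.inclusion_injective hK)
  have := Fintype.ofFinite H
  have := Fintype.ofFinite K
  -- Summing the signs over `W ∈ K` first keeps only the `U` that commute with all of `K`; the sign
  -- is symmetric, so the roles can be exchanged.
  have key : ∀ (H K : Subgroup (QubitUnitary n)) (_ : H ≤ pauliGroup n) (_ : K ≤ pauliGroup n)
      [Fintype H] [Fintype K], ∑ U : H, ∑ W : K, commSign (U : QubitUnitary n) W =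
      Nat.card K * Nat.card (H ⊓ Subgroup.centralizer (K : Set (QubitUnitary n)) :
        Subgroup (QubitUnitary n)) := by
    intro H K hH hK _ _
    rw [Finset.sum_congr rfl fun U _ => sum_commSign K hK (hH U.2), ← Finset.sum_filter,
      Finset.sum_const, nsmul_eq_mul, mul_comm, ← Fintype.card_subtype, ← Nat.card_eq_fintype_card]
    congr 2
    refine Nat.card_congr ((Equiv.subtypeSubtypeEquivSubtypeInter (fun U => U ∈ H)
      (fun U => ∀ W ∈ K, U * W = W * U)).trans (Equiv.subtypeEquivRight fun U => ?_))
    rw [Subgroup.mem_inf, Subgroup.mem_centralizer_iff]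
    exact and_congr Iff.rfl (forall₂_congr fun W _ => eq_comm)
  have h1 := key H K hH hK
  have h2 := key K H hK hH
  rw [Finset.sum_comm] at h2
  simp only [fun (U : H) (W : K) => commSign_comm (W : QubitUnitary n) U] at h2
  zify
  rw [← h1, ← h2]

/-- If `U` is nontrivial at some `j ∈ A`, a single-qubit Pauli at `j` anticommutes with it. -/
theorem commute_pauliOn_compl_iff {A : Finset (Fin n)} {U : QubitUnitary n}
    (hU : U ∈ pauliGroup n) : (∀ W ∈ pauliOn A, U * W = W * U) ↔ U ∈ pauliOn Aᶜ := by
  obtain ⟨c, P, -, hUP⟩ := hU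
  constructor
  · intro h
    refine ⟨c, P, fun j hj => ?_, hUP⟩
    by_contra hne
    rw [Finset.mem_compl, not_not] at hj
    obtain ⟨t, ht⟩ : ∃ t : Fin 4, pauliSign (P j) t = -1 := by
      -- `X` anticommutes with `Y` and `Z`; against `X` itself, `Y` is used.
      refine ⟨if P j = 1 then 2 else 1, ?_⟩
      generalize P j = s at hne
      fin_cases s <;> simp [pauliSign] at hne ⊢
    let W : QubitUnitary n := ⟨pauliString (Pi.single j t), pauliString_isUnitary _⟩
    have hW : (W : Matrix (Bits (Fin n)) (Bits (Fin n)) ℂ) =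
        Complex.I ^ 0 • pauliString (Pi.single j t) := by rw [pow_zero, one_smul]
    have h1 := coe_mul_comm_of_eq hUP hW
    rw [Finset.prod_eq_single j (fun i _ hi => by simp [pauliSign, hi]) (by simp),
      Pi.single_eq_same, ht, neg_one_smul] at h1
    have hWA : W ∈ pauliOn A :=
      ⟨0, _, fun i hi => Pi.single_eq_of_ne (by rintro rfl; exact hi hj) _, hW⟩
    exact QubitUnitary.neg_ne (W * U) ((Subtype.ext h1 : U * W = -(W * U)).symm.trans (h W hWA))
  · rintro ⟨c', P', hP', hUP'⟩ W ⟨d, Q, hQ, hW⟩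
    refine Subtype.ext ?_
    rw [coe_mul_comm_of_eq hUP' hW, Finset.prod_eq_one, one_smul]
    intro j _
    by_cases hj : j ∈ A
    · simp [pauliSign, hP' j (by simpa using hj)]
    · simp [pauliSign, hQ j hj]

end Pauli

/-! ### The order of the group of cleaned logical operators -/

section Count

variable {n k d : ℕ} {S : Subgroup (QubitUnitary n)}

theorem phases_le (A : Finset (Fin n)) : phases n ≤ pauliOn A := pauliOn_mono (by simp)

/-- A normalizing Pauli that anticommutes with some `W ∈ S` would conjugate it to `-W`, putting `-I`
in `S`. -/
theorem IsStabilizerGroup.normalizerOn_eq (hS : IsStabilizerGroup S k d) (A : Finset (Fin n)) :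
    normalizerOn S A = pauliOn A ⊓ Subgroup.centralizer (S : Set (QubitUnitary n)) := by
  ext U
  rw [normalizerOn, Subgroup.mem_inf, Subgroup.mem_inf, and_comm]
  refine and_congr_right fun hU => ?_
  rw [Subgroup.mem_centralizer_iff]
  constructor
  · intro h W hW
    rcases pauli_commute_or_anticommute (pauliOn_mono (Finset.subset_univ A) hU)
      (hS.le_pauliGroup hW) with h1 | h1
    · exact h1.symm
    · refine absurd ?_ hS.neg_one_notMem
      have h2 : U * W * U⁻¹ ∈ S := (h W).1 hW
      rw [h1, neg_mul, mul_inv_cancel_right] at h2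
      have h3 := S.mul_mem h2 (S.inv_mem hW)
      rwa [neg_mul, mul_inv_cancel] at h3
  · intro h W
    constructor
    · intro hW
      change U * W * U⁻¹ ∈ S
      rwa [← h W hW, mul_inv_cancel_right]
    · intro hW
      change U * W * U⁻¹ ∈ S at hW
      have := h _ hW
      rw [inv_mul_cancel_right] at this
      rwa [← mul_left_cancel this] at hW

/-- Any phase other than `1` is `-1` or has square `-1`. -/
theorem IsStabilizerGroup.eq_one_of_mem_phases (hS : IsStabilizerGroup S k d)
    {U : QubitUnitary n} (hU : U ∈ S) (hp : U ∈ phases n) : U = 1 := by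
  obtain ⟨c, P, hP, h⟩ := hp
  have hP0 : P = 0 := funext fun j => hP j (by simp)
  rw [hP0, pauliString_zero] at h
  have hneg : ∀ W ∈ S, (W : Matrix (Bits (Fin n)) (Bits (Fin n)) ℂ) ≠ -1 := by
    intro W hW hW1
    exact hS.neg_one_notMem ((Subtype.ext hW1 : W = -1) ▸ hW)
  have hU2 : ((U * U : QubitUnitary n) : Matrix (Bits (Fin n)) (Bits (Fin n)) ℂ) =
      (Complex.I ^ (c % 4) * Complex.I ^ (c % 4)) • 1 := by
    rw [Submonoid.coe_mul, h, smul_mul_smul_comm, one_mul, I_pow_mod_four]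
  rw [← I_pow_mod_four] at h
  have hc : c % 4 < 4 := Nat.mod_lt _ (by norm_num)
  have hUU := hneg _ (S.mul_mem hU hU)
  have hU1 := hneg _ hU
  rw [hU2] at hUU
  rw [h] at hU1
  refine Subtype.ext (h.trans ?_)
  interval_cases c % 4
  · simp
  · simp at hUU
  · simp at hU1
  · simp [Complex.I_pow_three] at hUU

instance phases_normal : (phases n).Normal :=
  ⟨fun z hz U => by rwa [phases_comm hz]⟩

/-- The four phases meet `S` trivially, so every element factors uniquely as a stabilizer times a
phase. -/
theorem IsStabilizerGroup.card_stabilizerOn (hS : IsStabilizerGroup S k d) (A : Finset (Fin n)) :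
    Nat.card (stabilizerOn S A) =
      4 * Nat.card (S ⊓ pauliOn A : Subgroup (QubitUnitary n)) := by
  have hdisj : Disjoint (S ⊓ pauliOn A) (phases n) := by
    rw [Subgroup.disjoint_def]
    exact fun hx hp => hS.eq_one_of_mem_phases hx.1 hp
  let g : (S ⊓ pauliOn A : Subgroup (QubitUnitary n)) × phases n → stabilizerOn S A :=
    fun p => ⟨p.1 * p.2, Subgroup.mul_mem_sup p.1.2 p.2.2⟩
  have hg : Function.Bijective g := by
    constructor
    · intro p q h
      exact Subgroup.mul_injective_of_disjoint hdisj (congrArg Subtype.val h)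
    · rintro ⟨U, hU⟩
      have hU' : U ∈ (((S ⊓ pauliOn A) ⊔ phases n : Subgroup (QubitUnitary n)) :
        Set (QubitUnitary n)) := hU
      rw [Subgroup.mul_normal] at hU'
      obtain ⟨x, hx, z, hz, rfl⟩ := hU'
      exact ⟨(⟨x, hx⟩, ⟨z, hz⟩), rfl⟩
  rw [← Nat.card_eq_of_bijective g hg, Nat.card_prod, card_pauliOn, Finset.card_empty, pow_zero,
    mul_one, mul_comm]

theorem IsStabilizerGroup.stabilizerOn_le_normalizerOn (hS : IsStabilizerGroup S k d)
    (A : Finset (Fin n)) : stabilizerOn S A ≤ normalizerOn S A := by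
  rw [hS.normalizerOn_eq]
  refine sup_le (fun U hU => ⟨hU.2, ?_⟩) (fun U hU => ⟨phases_le A hU, ?_⟩)
  · exact Subgroup.mem_centralizer_iff.2 fun W hW => hS.comm W hW U hU.1
  · exact Subgroup.mem_centralizer_iff.2 fun W _ => mul_inv_eq_iff_eq_mul.1 (phases_comm hU W)

/-- Double counting for `S` against all Paulis on `A`: the stabilizers commuting with the latter are
those supported on `Aᶜ`. -/
theorem IsStabilizerGroup.card_mul_card_normalizerOn (hS : IsStabilizerGroup S k d)
    (A : Finset (Fin n)) :
    2 ^ (n - k) * Nat.card (normalizerOn S A) =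
      4 * 4 ^ A.card * Nat.card (S ⊓ pauliOn Aᶜ : Subgroup (QubitUnitary n)) := by
  have h : S ⊓ Subgroup.centralizer (pauliOn A : Set (QubitUnitary n)) = S ⊓ pauliOn Aᶜ := by
    ext U
    rw [Subgroup.mem_inf, Subgroup.mem_inf, Subgroup.mem_centralizer_iff]
    refine and_congr_right fun hU => ?_
    rw [← commute_pauliOn_compl_iff (hS.le_pauliGroup hU)]
    exact forall₂_congr fun W _ => eq_comm
  rw [hS.normalizerOn_eq, ← hS.card_eq, ← card_pauliOn, ← h]
  exact card_mul_card_commuting (pauliOn_mono (Finset.subset_univ A)) hS.le_pauliGroup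

/-- `|S| |G_A| |S_A| = 4 ^ |A| |S_{Aᶜ}|`. -/
theorem IsStabilizerGroup.card_cleanedLogicals (hS : IsStabilizerGroup S k d)
    (A : Finset (Fin n)) :
    2 ^ (n - k) * Nat.card (CleanedLogicals S A) *
        Nat.card (S ⊓ pauliOn A : Subgroup (QubitUnitary n)) =
      4 ^ A.card * Nat.card (S ⊓ pauliOn Aᶜ : Subgroup (QubitUnitary n)) := by
  have h1 := Subgroup.card_eq_card_quotient_mul_card_subgroup
    ((stabilizerOn S A).subgroupOf (normalizerOn S A))
  rw [Nat.card_congr (Subgroup.subgroupOfEquivOfLe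
    (hS.stabilizerOn_le_normalizerOn A)).toEquiv, hS.card_stabilizerOn] at h1
  have h2 := hS.card_mul_card_normalizerOn A
  rw [h1] at h2
  apply Nat.eq_of_mul_eq_mul_left (show 0 < 4 by norm_num)
  linarith

end Count

/-! ### The projector onto the code space -/

section CodeProjector

variable {n k d : ℕ} {S : Subgroup (QubitUnitary n)}

theorem mul_sum_subgroup [Fintype S] {t : QubitUnitary n} (ht : t ∈ S) :
    (t : Matrix (Bits (Fin n)) (Bits (Fin n)) ℂ) *
        ∑ s : S, ((s : QubitUnitary n) : Matrix (Bits (Fin n)) (Bits (Fin n)) ℂ) =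
      ∑ s : S, ((s : QubitUnitary n) : Matrix (Bits (Fin n)) (Bits (Fin n)) ℂ) := by
  rw [Finset.mul_sum]
  exact Fintype.sum_equiv (Equiv.mulLeft (⟨t, ht⟩ : S)) _ _ fun s => rfl

theorem conjTranspose_sum_subgroup [Fintype S] :
    (∑ s : S, ((s : QubitUnitary n) : Matrix (Bits (Fin n)) (Bits (Fin n)) ℂ))ᴴ =
      ∑ s : S, ((s : QubitUnitary n) : Matrix (Bits (Fin n)) (Bits (Fin n)) ℂ) := by
  rw [Matrix.conjTranspose_sum]
  exact Fintype.sum_equiv (Equiv.inv S) _ _ fun s => rfl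

theorem IsEncoder.mulVec_mem {V : Matrix (Bits (Fin n)) (Bits (Fin k)) ℂ} (hV : IsEncoder S V)
    (v : Bits (Fin k) → ℂ) : V *ᵥ v ∈ codeSpace S :=
  hV.range_eq ▸ ⟨v, rfl⟩

/-- Let `T` be the sum over `S`. Stabilizers fix the columns of `V`, so `T V = |S| V`; the columns
of `T` are code vectors, so `V Vᴴ T = T`. Comparing with the adjoint of the latter gives the
formula. -/
theorem IsEncoder.mul_conjTranspose [Fintype S] {V : Matrix (Bits (Fin n)) (Bits (Fin k)) ℂ}
    (hV : IsEncoder S V) : V * Vᴴ = (Nat.card S : ℂ)⁻¹ •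
      ∑ s : S, ((s : QubitUnitary n) : Matrix (Bits (Fin n)) (Bits (Fin n)) ℂ) := by
  set T := ∑ s : S, ((s : QubitUnitary n) : Matrix (Bits (Fin n)) (Bits (Fin n)) ℂ) with hT
  have h1 : T * V = (Nat.card S : ℂ) • V := by
    have h : ∀ s : S, ((s : QubitUnitary n) : Matrix (Bits (Fin n)) (Bits (Fin n)) ℂ) * V = V := by
      intro s
      refine Matrix.ext_of_mulVec_single fun j => ?_
      rw [← Matrix.mulVec_mulVec]
      exact hV.mulVec_mem _ s s.2
    rw [hT, Matrix.sum_mul, Finset.sum_congr rfl fun s _ => h s, Finset.sum_const,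
      Finset.card_univ, ← Nat.card_eq_fintype_card, Nat.cast_smul_eq_nsmul]
  have h2 : V * Vᴴ * T = T := by
    refine Matrix.ext_of_mulVec_single fun j => ?_
    have hmem : T *ᵥ Pi.single j 1 ∈ codeSpace S := fun s hs => by
      rw [Matrix.mulVec_mulVec, mul_sum_subgroup hs]
    rw [← hV.range_eq] at hmem
    obtain ⟨u, hu⟩ := hmem
    rw [Matrix.mulVecLin_apply] at hu
    rw [← Matrix.mulVec_mulVec, ← hu, Matrix.mulVec_mulVec, Matrix.mul_assoc, hV.isometry,
      Matrix.mul_one]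
  have h3 : T * (V * Vᴴ) = T := by
    have := congrArg Matrix.conjTranspose h2
    rwa [Matrix.conjTranspose_mul, Matrix.conjTranspose_mul, Matrix.conjTranspose_conjTranspose,
      conjTranspose_sum_subgroup] at this
  rw [← Matrix.mul_assoc, h1, Matrix.smul_mul] at h3
  rw [← h3, smul_smul, inv_mul_cancel₀, one_smul]
  exact_mod_cast Nat.card_pos.ne'

end CodeProjector

/-! ### Flatness of the marginals of the code projector -/

section Flat

variable {n k d : ℕ}

theorem traceLeft_kronecker {x y : Type} [Fintype x] (a : Matrix x x ℂ) (b : Matrix y y ℂ) :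
    traceLeft (a ⊗ₖ b) = a.trace • b := by
  ext i j
  simp [traceLeft, Matrix.trace, Finset.sum_mul]

theorem traceLeft_sum {x y ι : Type} [Fintype x] (s : Finset ι)
    (f : ι → Matrix (x × y) (x × y) ℂ) : traceLeft (∑ i ∈ s, f i) = ∑ i ∈ s, traceLeft (f i) := by
  ext a b
  simp only [traceLeft, Matrix.of_apply, Matrix.sum_apply]
  exact Finset.sum_comm

theorem traceLeft_smul {x y : Type} [Fintype x] (c : ℂ) (ρ : Matrix (x × y) (x × y) ℂ) :
    traceLeft (c • ρ) = c • traceLeft ρ := by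
  ext a b
  simp [traceLeft, Finset.mul_sum]

/-- If every element of `S` either acts trivially on the first factor (and lies in `T`) or has
vanishing partial trace, then the marginal of the sum of `S` is proportional to a projector. -/
theorem traceLeft_sum_mul_self {x y : Type} [Fintype x] [DecidableEq x] [Fintype y]
    {S T : Subgroup (QubitUnitary n)} [Fintype S] (hTS : T ≤ S) (J : x × y ≃ Bits (Fin n))
    (h1 : ∀ s ∈ T, ∃ a : Matrix y y ℂ,
      (s : Matrix (Bits (Fin n)) (Bits (Fin n)) ℂ).submatrix J J = 1 ⊗ₖ a)
    (h0 : ∀ s ∈ S, s ∉ T →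
      traceLeft ((s : Matrix (Bits (Fin n)) (Bits (Fin n)) ℂ).submatrix J J) = 0) :
    traceLeft ((∑ s : S, ((s : QubitUnitary n) :
        Matrix (Bits (Fin n)) (Bits (Fin n)) ℂ)).submatrix J J) *
      traceLeft ((∑ s : S, ((s : QubitUnitary n) :
        Matrix (Bits (Fin n)) (Bits (Fin n)) ℂ)).submatrix J J) =
      ((Fintype.card x * Nat.card T : ℝ) : ℂ) •
        traceLeft ((∑ s : S, ((s : QubitUnitary n) :
        Matrix (Bits (Fin n)) (Bits (Fin n)) ℂ)).submatrix J J) := by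
  classical
  set B := ∑ s : S, ((s : QubitUnitary n) : Matrix (Bits (Fin n)) (Bits (Fin n)) ℂ) with hB
  have hsum : B.submatrix J J = ∑ s : S,
      ((s : QubitUnitary n) : Matrix (Bits (Fin n)) (Bits (Fin n)) ℂ).submatrix J J := by
    ext a b
    simp [hB, Matrix.sum_apply]
  -- For `s = 1 ⊗ a` in `T`, the factor `a` can be moved inside the partial trace, where `s` is
  -- absorbed by the group sum. Tracing out the identity gives the dimension.
  have hterm : ∀ s : S, traceLeft (((s : QubitUnitary n) :
      Matrix (Bits (Fin n)) (Bits (Fin n)) ℂ).submatrix J J) * traceLeft (B.submatrix J J) =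
      if (s : QubitUnitary n) ∈ T then (Fintype.card x : ℂ) • traceLeft (B.submatrix J J)
      else 0 := by
    intro s
    split_ifs with hs
    · obtain ⟨a, ha⟩ := h1 s hs
      rw [ha, traceLeft_kronecker, Matrix.trace_one, Matrix.smul_mul,
        ← traceLeft_one_kronecker_mul, ← ha, Matrix.submatrix_mul_equiv, mul_sum_subgroup s.2]
    · rw [h0 s s.2 hs, Matrix.zero_mul]
  have hcard : (Finset.univ.filter fun s : S => (s : QubitUnitary n) ∈ T).card = Nat.card T := by
    rw [← Fintype.card_subtype, ← Nat.card_eq_fintype_card]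
    exact Nat.card_congr (Subgroup.subgroupOfEquivOfLe hTS).toEquiv
  have htr := traceLeft_sum Finset.univ fun s : S =>
    ((s : QubitUnitary n) : Matrix (Bits (Fin n)) (Bits (Fin n)) ℂ).submatrix J J
  rw [← hsum] at htr
  nth_rw 1 [htr]
  rw [Matrix.sum_mul, Finset.sum_congr rfl fun s _ => hterm s,
    ← Finset.sum_filter, Finset.sum_const, hcard, ← Nat.cast_smul_eq_nsmul ℂ, smul_smul]
  push_cast
  rw [mul_comm]

/-- The tensor product of Pauli matrices on the qubits indexed by `ι`. -/
def pauliTensor {ι : Type} [Fintype ι] (P : ι → Fin 4) : Matrix (Bits ι) (Bits ι) ℂ :=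
  Matrix.of fun a b => ∏ j, pauliMatrix (P j) (a j) (b j)

theorem pauliTensor_zero {ι : Type} [Fintype ι] {P : ι → Fin 4} (h : ∀ j, P j = 0) :
    pauliTensor P = 1 := by
  classical
  ext a b
  simp only [pauliTensor, Matrix.of_apply, h, pauliMatrix, Matrix.cons_val_zero, Matrix.one_apply]
  rw [Finset.prod_ite_zero]
  simp [funext_iff]

theorem trace_pauliTensor_eq_zero {ι : Type} [Fintype ι] [DecidableEq ι] {P : ι → Fin 4} {j : ι}
    (h : P j ≠ 0) : (pauliTensor P).trace = 0 := by
  have h1 : (pauliTensor P).trace = ∏ j, (pauliMatrix (P j)).trace := by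
    simp only [Matrix.trace, Matrix.diag_apply, pauliTensor, Matrix.of_apply]
    rw [Finset.prod_univ_sum, Fintype.piFinset_univ]
  rw [h1]
  exact Finset.prod_eq_zero (Finset.mem_univ j) (by rw [trace_pauliMatrix, if_neg h])

/-- The splitting of the qubits into those in `M` and those outside `M`. -/
def splitBits (M : Finset (Fin n)) :
    Bits {j // j ∈ M} × Bits {j // j ∉ M} ≃ Bits (Fin n) where
  toFun p := joinBits M p.1 p.2
  invFun b := (fun j => b j, fun j => b j)
  left_inv p := by
    refine Prod.ext (funext fun j => ?_) (funext fun j => ?_)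
    · simp [joinBits, j.2]
    · simp [joinBits, j.2]
  right_inv b := by
    funext j
    by_cases h : j ∈ M <;> simp [joinBits, h]

theorem pauliString_joinBits (M : Finset (Fin n)) (P : Fin n → Fin 4)
    (x x' : Bits {j // j ∈ M}) (c c' : Bits {j // j ∉ M}) :
    pauliString P (joinBits M x c) (joinBits M x' c') =
      pauliTensor (fun j : {j // j ∈ M} => P j) x x' *
        pauliTensor (fun j : {j // j ∉ M} => P j) c c' := by
  simp only [pauliString, pauliTensor, Matrix.of_apply]
  rw [← Fintype.prod_subtype_mul_prod_subtype (fun j => j ∈ M)]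
  congr 1
  · refine Finset.prod_congr (by ext; simp) fun j _ => ?_
    have hj : (j : Fin n) ∈ M := j.2
    simp [joinBits, hj]
  · refine Finset.prod_congr (by ext; simp) fun j _ => ?_
    have hj : (j : Fin n) ∉ M := j.2
    simp [joinBits, hj]

theorem pauliString_submatrix_splitBits (M : Finset (Fin n)) (P : Fin n → Fin 4) :
    (pauliString P).submatrix (splitBits M) (splitBits M) =
      pauliTensor (fun j : {j // j ∈ M} => P j) ⊗ₖ pauliTensor (fun j : {j // j ∉ M} => P j) :=
  Matrix.ext fun p q => pauliString_joinBits M P p.1 q.1 p.2 q.2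

theorem pauliString_submatrix_splitBits_swap (M : Finset (Fin n)) (P : Fin n → Fin 4) :
    (pauliString P).submatrix ((Equiv.prodComm _ _).trans (splitBits M))
        ((Equiv.prodComm _ _).trans (splitBits M)) =
      pauliTensor (fun j : {j // j ∉ M} => P j) ⊗ₖ pauliTensor (fun j : {j // j ∈ M} => P j) :=
  Matrix.ext fun p q => (pauliString_joinBits M P p.2 q.2 p.1 q.1).trans (mul_comm _ _)

variable {S : Subgroup (QubitUnitary n)} [Fintype S]

/-- Here `M` is traced out: a stabilizer not supported on `Mᶜ` has a traceless factor on some qubit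
of `M`. -/
theorem IsStabilizerGroup.traceLeft_splitBits_mul_self (hS : IsStabilizerGroup S k d)
    (M : Finset (Fin n)) {B : Matrix (Bits {j // j ∉ M}) (Bits {j // j ∉ M}) ℂ}
    (hB : B = traceLeft ((∑ s : S, ((s : QubitUnitary n) :
      Matrix (Bits (Fin n)) (Bits (Fin n)) ℂ)).submatrix (splitBits M) (splitBits M))) :
    B * B = ((2 ^ M.card * Nat.card (S ⊓ pauliOn Mᶜ : Subgroup (QubitUnitary n)) : ℝ) : ℂ) • B := by
  have h := traceLeft_sum_mul_self (S := S) (T := S ⊓ pauliOn Mᶜ) inf_le_left (splitBits M) ?_ ?_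
  · rw [← hB] at h
    simpa using h
  · rintro s ⟨-, c, P, hP, hs⟩
    refine ⟨Complex.I ^ c • pauliTensor fun j : {j // j ∉ M} => P j, ?_⟩
    rw [hs, Matrix.submatrix_smul, Pi.smul_apply, Pi.smul_apply, pauliString_submatrix_splitBits,
      pauliTensor_zero (fun j : {j // j ∈ M} => hP j (by simp [j.2])), Matrix.kronecker_smul]
  · intro s hs hsT
    obtain ⟨c, P, -, hsP⟩ := hS.le_pauliGroup hs
    obtain ⟨j, hj, hPj⟩ : ∃ j ∈ M, P j ≠ 0 := by
      by_contra! h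
      exact hsT ⟨hs, c, P, fun j hj => h j (by simpa using hj), hsP⟩
    rw [hsP, Matrix.submatrix_smul, Pi.smul_apply, Pi.smul_apply, traceLeft_smul,
      pauliString_submatrix_splitBits, traceLeft_kronecker,
      trace_pauliTensor_eq_zero (j := (⟨j, hj⟩ : {j // j ∈ M})) hPj, zero_smul, smul_zero]

theorem IsStabilizerGroup.traceLeft_splitBits_swap_mul_self (hS : IsStabilizerGroup S k d)
    (M : Finset (Fin n)) {B : Matrix (Bits {j // j ∈ M}) (Bits {j // j ∈ M}) ℂ}
    (hB : B = traceLeft ((∑ s : S, ((s : QubitUnitary n) :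
      Matrix (Bits (Fin n)) (Bits (Fin n)) ℂ)).submatrix ((Equiv.prodComm _ _).trans (splitBits M))
        ((Equiv.prodComm _ _).trans (splitBits M)))) :
    B * B = ((2 ^ Mᶜ.card * Nat.card (S ⊓ pauliOn M : Subgroup (QubitUnitary n)) : ℝ) : ℂ) • B := by
  have h := traceLeft_sum_mul_self (S := S) (T := S ⊓ pauliOn M) inf_le_left
    ((Equiv.prodComm _ _).trans (splitBits M)) ?_ ?_
  · rw [← hB] at h
    simpa [Fintype.card_subtype_compl, Finset.card_compl] using h
  · rintro s ⟨-, c, P, hP, hs⟩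
    refine ⟨Complex.I ^ c • pauliTensor fun j : {j // j ∈ M} => P j, ?_⟩
    rw [hs, Matrix.submatrix_smul, Pi.smul_apply, Pi.smul_apply,
      pauliString_submatrix_splitBits_swap,
      pauliTensor_zero (fun j : {j // j ∉ M} => hP j j.2), Matrix.kronecker_smul]
  · intro s hs hsT
    obtain ⟨c, P, -, hsP⟩ := hS.le_pauliGroup hs
    obtain ⟨j, hj, hPj⟩ : ∃ j, j ∉ M ∧ P j ≠ 0 := by
      by_contra! h
      exact hsT ⟨hs, c, P, h, hsP⟩
    rw [hsP, Matrix.submatrix_smul, Pi.smul_apply, Pi.smul_apply, traceLeft_smul,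
      pauliString_submatrix_splitBits_swap, traceLeft_kronecker,
      trace_pauliTensor_eq_zero (j := (⟨j, hj⟩ : {j // j ∉ M})) hPj, zero_smul, smul_zero]

end Flat

/-! ### The erased state -/

section ErasedState

variable {n k d : ℕ} {S : Subgroup (QubitUnitary n)}
  {V : Matrix (Bits (Fin n)) (Bits (Fin k)) ℂ}

theorem encodedState_apply (V : Matrix (Bits (Fin n)) (Bits (Fin k)) ℂ) (r : Bits (Fin k))
    (b : Bits (Fin n)) :
    encodedState V (r, b) = ((1 / Real.sqrt (Fintype.card (Bits (Fin k))) : ℝ) : ℂ) * V b r := by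
  simp only [encodedState, Matrix.mulVec, dotProduct, maxEntangled, Fintype.sum_prod_type,
    Matrix.kroneckerMap_apply, Matrix.one_apply, mul_ite, mul_zero, Finset.sum_ite_eq,
    Finset.mem_univ, if_true, ite_mul, one_mul, zero_mul]
  exact mul_comm _ _

/-- The encoded state as an operator from the erased qubits to the reference system and the
qubits in `M`. -/
noncomputable def schmidtMatrix (V : Matrix (Bits (Fin n)) (Bits (Fin k)) ℂ)
    (M : Finset (Fin n)) : Matrix (Bits (Fin k) × Bits {j // j ∈ M}) (Bits {j // j ∉ M}) ℂ :=
  Matrix.of fun p c => encodedState V (p.1, joinBits M p.2 c)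

theorem erasedState_eq (V : Matrix (Bits (Fin n)) (Bits (Fin k)) ℂ) (M : Finset (Fin n)) :
    erasedState V M = schmidtMatrix V M * (schmidtMatrix V M)ᴴ :=
  rfl

theorem encodedState_mul_star (V : Matrix (Bits (Fin n)) (Bits (Fin k)) ℂ)
    (a b : Bits (Fin n)) : ∑ r, encodedState V (r, a) * star (encodedState V (r, b)) =
      ((2 : ℂ) ^ k)⁻¹ * (V * Vᴴ) a b := by
  have hs : ((1 / Real.sqrt (Fintype.card (Bits (Fin k))) : ℝ) : ℂ) *
      ((1 / Real.sqrt (Fintype.card (Bits (Fin k))) : ℝ) : ℂ) = ((2 : ℂ) ^ k)⁻¹ := by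
    rw [← Complex.ofReal_mul, div_mul_div_comm, Real.mul_self_sqrt (Nat.cast_nonneg _)]
    simp
  rw [← hs, Matrix.mul_apply, Finset.mul_sum]
  refine Finset.sum_congr rfl fun r _ => ?_
  rw [encodedState_apply, encodedState_apply, star_mul', Complex.star_def, Complex.conj_ofReal,
    Matrix.conjTranspose_apply, Complex.star_def]
  ring

/-- Up to transposition, this is the reduced state on the erased qubits, in which the reference
system no longer appears. -/
theorem schmidtMatrix_conjTranspose_mul_self (V : Matrix (Bits (Fin n)) (Bits (Fin k)) ℂ)
    (M : Finset (Fin n)) : (schmidtMatrix V M)ᴴ * schmidtMatrix V M =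
      ((2 : ℂ) ^ k)⁻¹ • (traceLeft ((V * Vᴴ).submatrix (splitBits M) (splitBits M)))ᵀ := by
  ext c c'
  rw [Matrix.mul_apply, Fintype.sum_prod_type, Finset.sum_comm, Matrix.smul_apply,
    Matrix.transpose_apply, traceLeft, Matrix.of_apply, smul_eq_mul, Finset.mul_sum]
  refine Finset.sum_congr rfl fun x _ => ?_
  refine Eq.trans (Finset.sum_congr rfl fun r _ => ?_) (encodedState_mul_star V _ _)
  rw [mul_comm]
  rfl

theorem traceLeft_erasedState (V : Matrix (Bits (Fin n)) (Bits (Fin k)) ℂ)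
    (M : Finset (Fin n)) : traceLeft (erasedState V M) = ((2 : ℂ) ^ k)⁻¹ •
      traceLeft ((V * Vᴴ).submatrix ((Equiv.prodComm _ _).trans (splitBits M))
        ((Equiv.prodComm _ _).trans (splitBits M))) := by
  ext x x'
  rw [traceLeft, Matrix.of_apply, Matrix.smul_apply, traceLeft, Matrix.of_apply, smul_eq_mul,
    Finset.mul_sum]
  refine (Finset.sum_comm (f := fun r c => encodedState V (r, joinBits M x c) *
    star (encodedState V (r, joinBits M x' c)))).trans ?_
  exact Finset.sum_congr rfl fun c _ => encodedState_mul_star V _ _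

theorem trace_erasedState (hV : Vᴴ * V = 1) (M : Finset (Fin n)) :
    (erasedState V M).trace = 1 := by
  rw [← trace_traceLeft, traceLeft_erasedState, Matrix.trace_smul, trace_traceLeft,
    show ∀ e : Bits {j // j ∉ M} × Bits {j // j ∈ M} ≃ Bits (Fin n),
      ((V * Vᴴ).submatrix e e).trace = (V * Vᴴ).trace from fun e => e.sum_comp fun b => (V * Vᴴ) b b,
    Matrix.trace_mul_comm, hV, Matrix.trace_one]
  simp

/-- `K Kᴴ` and `Kᴴ K` have the same nonzero spectrum, so flatness passes from one to the other. -/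
theorem Matrix.mul_conjTranspose_mul_self_of_flat {p q : Type} [Fintype p] [Fintype q]
    [DecidableEq q] {K : Matrix p q ℂ} {c : ℝ} (h : Kᴴ * K * (Kᴴ * K) = (c : ℂ) • (Kᴴ * K)) :
    K * Kᴴ * (K * Kᴴ) = (c : ℂ) • (K * Kᴴ) := by
  -- With `X = K Kᴴ K - c K`, the flatness of `Kᴴ K` makes the terms of `Xᴴ X` cancel.
  have h1 : K * (Kᴴ * K) - (c : ℂ) • K = 0 := by
    rw [← Matrix.conjTranspose_mul_self_eq_zero, Matrix.conjTranspose_sub, Matrix.conjTranspose_mul,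
      Matrix.conjTranspose_mul, Matrix.conjTranspose_smul, Matrix.conjTranspose_conjTranspose,
      Complex.star_def, Complex.conj_ofReal, Matrix.sub_mul, Matrix.mul_sub, Matrix.mul_sub,
      Matrix.smul_mul,
      Matrix.smul_mul, Matrix.mul_smul, Matrix.mul_smul]
    rw [Matrix.mul_assoc (Kᴴ * K) Kᴴ (K * (Kᴴ * K)), ← Matrix.mul_assoc Kᴴ K (Kᴴ * K), h,
      Matrix.mul_assoc (Kᴴ * K) Kᴴ K, h, Matrix.mul_smul, h]
    simp
  rw [sub_eq_zero] at h1
  calc K * Kᴴ * (K * Kᴴ) = K * (Kᴴ * K) * Kᴴ := by simp only [Matrix.mul_assoc]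
    _ = _ := by rw [h1, Matrix.smul_mul]

theorem smul_flat {m : Type} [Fintype m] {B : Matrix m m ℂ} {b : ℂ} (h : B * B = b • B) (z : ℂ) :
    (z • B) * (z • B) = (z * b) • (z • B) := by
  rw [smul_mul_smul_comm, h, smul_smul, smul_smul]
  congr 1
  ring

theorem IsStabilizerGroup.two_pow_inv_mul (hS : IsStabilizerGroup S k d) :
    ((2 : ℂ) ^ k)⁻¹ * (Nat.card S : ℂ)⁻¹ = (((2 : ℝ) ^ n)⁻¹ : ℝ) := by
  rw [hS.card_eq, ← mul_inv]
  push_cast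
  rw [← pow_add, Nat.add_sub_cancel' hS.le_qubits]

/-- Flatness is proved for the complementary marginal on `Mᶜ` and carried over by purity. -/
theorem erasedState_mul_self (hS : IsStabilizerGroup S k d) (hV : IsEncoder S V)
    (M : Finset (Fin n)) : erasedState V M * erasedState V M =
      ((((2 : ℝ) ^ n)⁻¹ * (2 ^ M.card * Nat.card (S ⊓ pauliOn Mᶜ : Subgroup (QubitUnitary n))) :
        ℝ) : ℂ) • erasedState V M := by
  have : Finite S := Nat.finite_of_card_ne_zero (by rw [hS.card_eq]; positivity)
  have := Fintype.ofFinite S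
  rw [erasedState_eq]
  apply Matrix.mul_conjTranspose_mul_self_of_flat
  rw [schmidtMatrix_conjTranspose_mul_self, hV.mul_conjTranspose, Matrix.submatrix_smul,
    Pi.smul_apply, Pi.smul_apply, traceLeft_smul, Matrix.transpose_smul, smul_smul,
    hS.two_pow_inv_mul, Complex.ofReal_mul]
  apply smul_flat
  rw [← Matrix.transpose_mul, hS.traceLeft_splitBits_mul_self M rfl, Matrix.transpose_smul]

theorem traceLeft_erasedState_mul_self (hS : IsStabilizerGroup S k d) (hV : IsEncoder S V)
    (M : Finset (Fin n)) : traceLeft (erasedState V M) * traceLeft (erasedState V M) =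
      ((((2 : ℝ) ^ n)⁻¹ * (2 ^ Mᶜ.card * Nat.card (S ⊓ pauliOn M : Subgroup (QubitUnitary n))) :
        ℝ) : ℂ) • traceLeft (erasedState V M) := by
  have : Finite S := Nat.finite_of_card_ne_zero (by rw [hS.card_eq]; positivity)
  have := Fintype.ofFinite S
  rw [traceLeft_erasedState, hV.mul_conjTranspose, Matrix.submatrix_smul,
    Pi.smul_apply, Pi.smul_apply, traceLeft_smul, smul_smul,
    hS.two_pow_inv_mul, Complex.ofReal_mul]
  apply smul_flat
  exact hS.traceLeft_splitBits_swap_mul_self M rfl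

theorem IsStabilizerGroup.card_inf_pauliOn_pos (hS : IsStabilizerGroup S k d)
    (A : Finset (Fin n)) : 0 < Nat.card (S ⊓ pauliOn A : Subgroup (QubitUnitary n)) := by
  have : Finite S := Nat.finite_of_card_ne_zero (by rw [hS.card_eq]; positivity)
  have : Finite (S ⊓ pauliOn A : Subgroup (QubitUnitary n)) :=
    Finite.of_injective _ (Subgroup.inclusion_injective inf_le_left)
  exact Nat.card_pos

theorem IsStabilizerGroup.card_cleanedLogicals_pos (hS : IsStabilizerGroup S k d)
    (A : Finset (Fin n)) : 0 < Nat.card (CleanedLogicals S A) := by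
  have h := hS.card_cleanedLogicals A
  have h1 := hS.card_inf_pauliOn_pos Aᶜ
  rcases Nat.eq_zero_or_pos (Nat.card (CleanedLogicals S A)) with h0 | h0
  · rw [h0, mul_zero, zero_mul] at h
    have : 0 < 4 ^ A.card * Nat.card (S ⊓ pauliOn Aᶜ : Subgroup (QubitUnitary n)) := by positivity
    omega
  · exact h0

theorem IsStabilizerGroup.isGreatest_fidelity (hS : IsStabilizerGroup S k d)
    (hV : IsEncoder S V) (M : Finset (Fin n)) :
    IsGreatest
      {F : ℝ | ∃ 𝓡 : Matrix (Bits {j // j ∈ M}) (Bits {j // j ∈ M}) ℂ →ₗ[ℂ]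
          Matrix (Bits (Fin k)) (Bits (Fin k)) ℂ, IsChannel 𝓡 ∧
        F = fidelity (ketbra (maxEntangled (Bits (Fin k))))
          (idTensor (Bits (Fin k)) 𝓡 (erasedState V M))}
      (1 / (Nat.card (CleanedLogicals S Mᶜ) : ℝ)) := by
  have hA : (0 : ℝ) < Nat.card (S ⊓ pauliOn Mᶜ : Subgroup (QubitUnitary n)) := by
    exact_mod_cast hS.card_inf_pauliOn_pos Mᶜ
  have hM : (0 : ℝ) < Nat.card (S ⊓ pauliOn M : Subgroup (QubitUnitary n)) := by
    exact_mod_cast hS.card_inf_pauliOn_pos M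
  have hG : (0 : ℝ) < Nat.card (CleanedLogicals S Mᶜ) := by
    exact_mod_cast hS.card_cleanedLogicals_pos Mᶜ
  have h := isGreatest_fidelity_of_flat (schmidtMatrix V M) (erasedState_eq V M)
    (by positivity) (by positivity) (erasedState_mul_self hS hV M)
    (traceLeft_erasedState_mul_self hS hV M) (trace_erasedState hV.isometry M)
  have hcount : (2 : ℝ) ^ (n - k) * Nat.card (CleanedLogicals S Mᶜ) *
      Nat.card (S ⊓ pauliOn Mᶜ : Subgroup (QubitUnitary n)) =
      4 ^ Mᶜ.card * Nat.card (S ⊓ pauliOn M : Subgroup (QubitUnitary n)) := by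
    have := hS.card_cleanedLogicals Mᶜ
    rw [compl_compl] at this
    exact_mod_cast this
  have hpow : (2 : ℝ) ^ (n - k) * 2 ^ k = 2 ^ M.card * 2 ^ Mᶜ.card := by
    rw [← pow_add, ← pow_add, Nat.sub_add_cancel hS.le_qubits, Finset.card_add_card_compl,
      Fintype.card_fin]
  have h4 : (4 : ℝ) ^ Mᶜ.card = 2 ^ Mᶜ.card * 2 ^ Mᶜ.card := by
    rw [← mul_pow]; norm_num
  convert h using 1
  have hcard : (Fintype.card (Bits (Fin k)) : ℝ) = 2 ^ k := by simp
  rw [hcard]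
  generalize (Nat.card (CleanedLogicals S Mᶜ) : ℝ) = g at *
  generalize (Nat.card (S ⊓ pauliOn Mᶜ : Subgroup (QubitUnitary n)) : ℝ) = a at *
  generalize (Nat.card (S ⊓ pauliOn M : Subgroup (QubitUnitary n)) : ℝ) = b at *
  rw [h4] at hcount
  field_simp
  -- An extra factor `2^{|Mᶜ|}` produces the `4^{|Mᶜ|}` of the counting identity.
  have hx : (2 : ℝ) ^ Mᶜ.card ≠ 0 := by positivity
  apply mul_left_cancel₀ hx
  calc _ = (2 ^ Mᶜ.card * 2 ^ Mᶜ.card * b) * (2 : ℝ) ^ k := by ring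
    _ = ((2 : ℝ) ^ (n - k) * 2 ^ k) * (g * a) := by rw [← hcount]; ring
    _ = _ := by rw [hpow]; ring

theorem erasedState_posSemidef (V : Matrix (Bits (Fin n)) (Bits (Fin k)) ℂ)
    (M : Finset (Fin n)) : (erasedState V M).PosSemidef := by
  rw [erasedState_eq]
  exact Matrix.posSemidef_self_mul_conjTranspose _

end ErasedState

/-! ### From the optimal fidelity to the min-entropy -/

/-- The two definitions put `Φ` in different arguments of the fidelity, but both orders give the
overlap `⟨Φ|·|Φ⟩`; an attained maximum is the supremum. -/
theorem qCorr_eq_of_isGreatest {r e : Type} [Fintype r] [DecidableEq r] [Nonempty r] [Fintype e]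
    {ρ : Matrix (r × e) (r × e) ℂ} (hρ : ρ.PosSemidef) {F₀ : ℝ}
    (h : IsGreatest {F : ℝ | ∃ 𝓡 : Matrix e e ℂ →ₗ[ℂ] Matrix r r ℂ, IsChannel 𝓡 ∧
      F = fidelity (ketbra (maxEntangled r)) (idTensor r 𝓡 ρ)} F₀) :
    qCorr ρ = Fintype.card r * F₀ := by
  rw [qCorr, ← h.csSup_eq]
  congr 2
  ext F
  refine exists_congr fun 𝓡 => and_congr_right fun h𝓡 => ?_
  have hpos := h𝓡.completely_positive r ρ hρ
  rw [fidelity_ketbra_right hpos, fidelity_ketbra_left hpos star_maxEntangled_dotProduct_self]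

theorem theorem1 (n k d : ℕ) (S : Subgroup (QubitUnitary n)) (hS : IsStabilizerGroup S k d)
    (V : Matrix (Bits (Fin n)) (Bits (Fin k)) ℂ) (hV : IsEncoder S V) (M : Finset (Fin n)) :
    IsGreatest
      {F : ℝ | ∃ 𝓡 : Matrix (Bits {j // j ∈ M}) (Bits {j // j ∈ M}) ℂ →ₗ[ℂ]
          Matrix (Bits (Fin k)) (Bits (Fin k)) ℂ, IsChannel 𝓡 ∧
        F = fidelity (ketbra (maxEntangled (Bits (Fin k))))
          (idTensor (Bits (Fin k)) 𝓡 (erasedState V M))}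
      (1 / (Nat.card (CleanedLogicals S Mᶜ) : ℝ)) ∧
    condMinEntropy (erasedState V M) =
      - Real.logb 2 ((2 : ℝ) ^ k / (Nat.card (CleanedLogicals S Mᶜ) : ℝ)) ∧
    condMinEntropy (erasedState V M) =
      Real.logb 2 (Nat.card (CleanedLogicals S Mᶜ) : ℝ) - (k : ℝ) := by
  have h := hS.isGreatest_fidelity hV M
  have hG : (Nat.card (CleanedLogicals S Mᶜ) : ℝ) ≠ 0 := by
    exact_mod_cast (hS.card_cleanedLogicals_pos Mᶜ).ne'
  have hH : condMinEntropy (erasedState V M) =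
      - Real.logb 2 ((2 : ℝ) ^ k / (Nat.card (CleanedLogicals S Mᶜ) : ℝ)) := by
    rw [condMinEntropy, qCorr_eq_of_isGreatest (erasedState_posSemidef V M) h]
    simp [div_eq_mul_inv]
  refine ⟨h, hH, ?_⟩
  rw [hH, Real.logb_div (by positivity) hG, Real.logb_pow, Real.logb_self_eq_one (by norm_num)]
  ring
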